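/- **Setting.** Consider an episodic MDP with horizon $H\ge 1$, state space $\mathcal S$, action space $\mathcal A$, transition kernels $\mathbb P_h$, known deterministic rewards $r_h=R_h(x_h,a_h)\ge 0$ with $\sum_{h=1}^H R_h\le 1$, and a fixed law of the initial state $x_1$. $V^\pi$ is the expected total reward of a (history-dependent) policy $\pi$, $V^*=\sup_\pi V^\pi$, and $Q^*_h$ are the optimal action value functions. Let $\mathcal H=\mathcal H_1\times\dots\times\mathcal H_H$ be a hypothesis class ($\mathcal H_{H+1}$ is a one-point set). Each $f\in\mathcal H$ determines action value functions $Q_{h,f}$, the values $V_{h,f}(x)=\max_a Q_{h,f}(x,a)$, a greedy policy $\pi_f$ with $\pi_{h,f}(x)\in\operatorname{argmax}_a Q_{h,f}(x,a)$, the predicted value $V_f=\mathbb E\,V_{1,f}(x_1)$, and exploration policies $\pi_{\exp}(f,h)$, $h\in[H]$. (All objects are measurable.) **Assumptions.** 1. (Realizability) there is $f^*\in\mathcal H$ with $Q_{h,f^*}=Q^*_h$ for all $h$. 2. (Discrepancy function) there is a loss $l$ with $\ell_{f'}(f,(x_h,a_h))=\bigl|\mathbb E_{x_{h+1}\sim\mathbb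 P_h(\cdot|x_h,a_h)}\,l_{f'}((f_h,f_{h+1}),\zeta_h)\bigr|^2$, where $\zeta_h=(x_h,a_h,r_h,x_{h+1})$. 3. (Generalized completeness, boundedness) there are operators $\mathcal P_h:\mathcal H_{h+1}\to\mathcal H_h$ with $\mathcal P_hf^*_{h+1}=f^*_h$ and, for all $f',f_h,f_{h+1}$ and $\zeta_h$, $l_{f'}((f_h,f_{h+1}),\zeta_h)-l_{f'}((\mathcal P_hf_{h+1},f_{h+1}),\zeta_h)=\mathbb E_{x_{h+1}\sim\mathbb P_h(\cdot|x_h,a_h)}\,l_{f'}((f_h,f_{h+1}),\zeta_h)$; and $|l_{f'}((f_h,f_{h+1}),\zeta_h)|\le B_l$ always, for some $B_l>0$. **Complexity.** For $\epsilon>0$ and $T\ge1$ put $\mathrm{burn}(d,\epsilon)=2\sqrt{dHT}+\epsilon HT$. The generalized eluder coefficient $\mathrm{GEC}(\mathcal H,\ell,\Pi_{\exp},\epsilon)$ is the smallest $d\ge0$ such that for all $f^1,\dots,f^T\in\mathcal H$ $$\sum_{t=1}^T\bigl(V_{f^t}-V^{\pi_{f^t}}\bigr)\le\Bigl[d\sum_{h=1}^H\sum_{t=1}^T\sum_{s=1}^{t-1}\mathbb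 E_{\pi_{\exp}(f^s,h)}\,\ell_{f^s}(f^t,(x_h,a_h))\Bigr]^{1/2}+\mathrm{burn}(d,\epsilon).$$ Let $p^0=\prod_h p^0_h$ be a product prior on $\mathcal H$. Put $\mathcal F_h(\epsilon,f_{h+1})=\{f_h\in\mathcal H_h:\sup_{x,a,f'}|\mathbb E_{x_{h+1}\sim\mathbb P_h(\cdot|x,a)}\,l_{f'}((f_h,f_{h+1}),\zeta_h)|\le\epsilon\}$ and $\mathcal H(\epsilon)=\{f\in\mathcal H: V_{f^*}-V_f<\epsilon,\ \sup_{x,a,h,f'}|\mathbb E_{x_{h+1}\sim\mathbb P_h(\cdot|x,a)}\,l_{f'}((f_h,f_{h+1}),\zeta_h)|\le\epsilon\}$, and $$\kappa(\epsilon,p^0)=\max\Bigl\{\sum_{h=1}^H\sup_{f_{h+1}}-\log p^0_h(\mathcal F_h(\epsilon,f_{h+1})),\ -\log p^0(\mathcal H(\epsilon))\Bigr\}.$$ **Algorithm.** In iteration $t=1,\dots,T$ draw $f^t$ from $p^t(f)\propto p^0(f)\exp\bigl(\gamma V_f+\sum_{h}L_h^{1:t-1}(f)\bigr)$, where $$L_h^{1:t-1}(f)=-\eta\sum_{s<t}l_{f^s}((f_h,f_{h+1}),\zeta_h^s)^2-\log\mathbb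 E_{\tilde f_h\sim p^0_h}\exp\Bigl(-\eta\sum_{s<t}l_{f^s}((\tilde f_h,f_{h+1}),\zeta^s_h)^2\Bigr);$$ then, for each $h\in[H]$, execute $\pi_{\exp}(f^t,h)$ in a separate episode and record $\zeta_h^t=(x_h^t,a_h^t,r_h^t,x_{h+1}^t)$. The predicted policy of iteration $t$ is $\pi_{f^t}$. Write $\mathrm{Reg}_{\mathrm{it}}(T)=\sum_{t=1}^T(V^*-V^{\pi_{f^t}})$. As an iteration takes $H$ episodes, the regret over the $HT$ episodes of $T$ iterations is $\mathrm{Reg}(HT)=H\cdot\mathrm{Reg}_{\mathrm{it}}(T)$. **Theorem.** Let $d=\mathrm{GEC}(\mathcal H,\ell,\Pi_{\exp},1/\sqrt T)$ and $\kappa=\kappa(1/T^2,p^0)$, and suppose that $0<d<\infty$, $\kappa<\infty$ and $T^2\kappa\ge H$. Set $\eta=3/(10B_l^2)$ and $\gamma=\sqrt{T\kappa/(B_l^2d)}$, and write $\mathrm{burn}=\mathrm{burn}(d,1/\sqrt T)=2\sqrt{dHT}+H\sqrt T$. There is an absolute constant $C$ such that under Assumptions 1-3: (i) $\mathbb E[\mathrm{Reg}(HT)]\le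 C\bigl(B_l\sqrt{d\cdot H\cdot(HT)\cdot\kappa}+H\cdot\mathrm{burn}\bigr)$; (ii) if the burn-in cost is not dominating, $H\cdot\mathrm{burn}\le B_l\sqrt{d\cdot H\cdot(HT)\cdot\kappa}$, then $\mathbb E[\mathrm{Reg}(HT)]\le C\,B_l\sqrt{d\cdot H\cdot(HT)\cdot\kappa}$; (iii) when every iteration is counted once: if $\mathrm{burn}\le B_l\sqrt{dHT\kappa}$, then $\mathbb E[\mathrm{Reg}_{\mathrm{it}}(T)]\le C\,B_l\sqrt{dHT\kappa}$. If moreover $\mathcal H$ is finite and every $p^0_h$ is uniform, then (i), (ii) and (iii) also hold with $\log|\mathcal H|$ in place of $\kappa$ in the bounds and in the conditions on $\mathrm{burn}$ (with the same $\gamma$). -/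

import Mathlib

open MeasureTheory ProbabilityTheory
open scoped ENNReal NNReal

noncomputable section

namespace ModelFree

/-! ### Episodic Markov decision processes -/

/-- An episodic MDP with horizon `H`, steps numbered `0, …, H - 1` (what is stored at steps `k ≥ H`
is never used). `ρ` is the law of the initial state (a Dirac mass when the initial state is fixed),
`P k` the transition kernel and `R k` the known deterministic reward of step `k`. Rewards are
non-negative and add up to at most `1` over an episode. -/
structure MDP (S A : Type*) [MeasurableSpace S] [MeasurableSpace A] (H : ℕ) where
  ρ : Measure S
  prob_ρ : IsProbabilityMeasure ρ
  P : ℕ → Kernel (S × A) S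
  markov_P : ∀ k, IsMarkovKernel (P k)
  R : ℕ → S × A → ℝ
  measurable_R : ∀ k, Measurable (R k)
  R_nonneg : ∀ k xa, 0 ≤ R k xa
  sum_R_le_one : ∀ τ : ℕ → S × A, ∑ k ∈ Finset.range H, R k (τ k) ≤ 1

attribute [instance] MDP.prob_ρ MDP.markov_P

/-- A (history-dependent, randomized) policy: at step `k` it maps the past state-action pairs and
the current state to a distribution over actions. -/
structure Policy (S A : Type*) [MeasurableSpace S] [MeasurableSpace A] where
  kern : ∀ k : ℕ, Kernel ((Fin k → S × A) × S) A
  markov_kern : ∀ k, IsMarkovKernel (kern k)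

attribute [instance] Policy.markov_kern

/-- A Markovian (randomized) policy. -/
structure MarkovPolicy (S A : Type*) [MeasurableSpace S] [MeasurableSpace A] where
  kern : ℕ → Kernel S A
  markov_kern : ∀ k, IsMarkovKernel (kern k)

attribute [instance] MarkovPolicy.markov_kern

/-- The deterministic Markovian policy that plays `act k x` in state `x` at step `k`. -/
def Policy.ofAct {S A : Type*} [MeasurableSpace S] [MeasurableSpace A]
    (act : ℕ → S → A) (hact : ∀ k, Measurable (act k)) : Policy S A where
  kern k := Kernel.deterministic (fun p : (Fin k → S × A) × S => act k p.2)
    ((hact k).comp measurable_snd)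
  markov_kern _ := inferInstance

namespace MDP

variable {S A : Type*} [MeasurableSpace S] [MeasurableSpace A] {H : ℕ} (M : MDP S A H)

/-- The kernel that, from a history, the current state and the current action, draws the next
state; it is Markov: only the current state and action matter. -/
def nextKernel (k : ℕ) : Kernel (((Fin k → S × A) × S) × A) S :=
  (M.P k).comap (fun q : ((Fin k → S × A) × S) × A => (q.1.2, q.2)) (by fun_prop)

/-- Joint law, when executing `π`, of the first `k` state-action pairs and of the state that
follows them. -/
def trajLaw (π : Policy S A) : (k : ℕ) → Measure ((Fin k → S × A) × S)
  | 0 => M.ρ.map (fun x => (Fin.elim0, x))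
  | k + 1 => ((trajLaw π k ⊗ₘ π.kern k) ⊗ₘ M.nextKernel k).map
      (fun q => (Fin.snoc (α := fun _ => S × A) q.1.1.1 (q.1.1.2, q.1.2), q.2))

/-- The law of the transition `(x, a, x')` (state, action, next state) at step `k` when
executing `π`. -/
def stepLaw (π : Policy S A) (k : ℕ) : Measure (S × A × S) :=
  ((M.trajLaw π k ⊗ₘ π.kern k) ⊗ₘ M.nextKernel k).map (fun q => (q.1.1.2, q.1.2, q.2))

/-- The sample `ζ = (x, a, r, x')` of the transition `(x, a, x')` at step `k`, where
`r = R_k(x, a)` is the (deterministic) reward. -/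
def zeta (k : ℕ) (y : S × A × S) : S × A × ℝ × S := (y.1, y.2.1, M.R k (y.1, y.2.1), y.2.2)

/-- `V^π`, the expected total reward of `π` over an episode. -/
def value (π : Policy S A) : ℝ :=
  ∫ τ, ∑ k : Fin H, M.R k (τ.1 k) ∂(M.trajLaw π H)

/-- `V^*`, the supremum of the values over all history-dependent policies. -/
def optValue : ℝ := ⨆ π : Policy S A, M.value π

/-- State value function of a Markovian policy from step `k` on, with `n` steps to go. -/
def stateValue (π : MarkovPolicy S A) : (n k : ℕ) → S → ℝ
  | 0, _, _ => 0
  | n + 1, k, x => ∫ a, (M.R k (x, a) + ∫ x', stateValue π n (k + 1) x' ∂(M.P k (x, a)))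
      ∂(π.kern k x)

/-- `Q_k^π(x, a)`, the action value function of a Markovian policy (for steps `k < H`). -/
def actionValue (π : MarkovPolicy S A) (k : ℕ) (x : S) (a : A) : ℝ :=
  M.R k (x, a) + ∫ x', M.stateValue π (H - (k + 1)) (k + 1) x' ∂(M.P k (x, a))

/-- `Q_k^*(x, a)`, the optimal action value function. -/
def optQ (k : ℕ) (x : S) (a : A) : ℝ := ⨆ π : MarkovPolicy S A, M.actionValue π k x a

end MDP

/-! ### Hypothesis classes

A hypothesis class is a product `∏ i, 𝓗 i` over `i : Fin (H + 1)`. For a step `h : Fin H` the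
components `f_h` and `f_{h+1}` of `f` are `f h.castSucc` and `f h.succ`. The last component, which
follows the final step, is a dummy: `𝓗 (Fin.last H)` has exactly one element. -/

/-- A hypothesis `f` determines action value functions `Q_f` and a greedy policy `π_f`, which
plays `act f k x ∈ argmax_a Q_{k,f}(x, a)`. In a value-based class `f` is itself the list of the
functions `Q_{k,f}`; in a model-based class `Q_f` is the optimal action value function of the
model `f`. -/
structure HypothesisClass {S A : Type*} [MeasurableSpace S] [MeasurableSpace A] {H : ℕ}
    (M : MDP S A H) (𝓗 : Fin (H + 1) → Type*) [∀ i, MeasurableSpace (𝓗 i)] where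
  Q : (∀ i, 𝓗 i) → ℕ → S → A → ℝ
  act : (∀ i, 𝓗 i) → ℕ → S → A
  measurable_Q : ∀ k, Measurable fun p : (∀ i, 𝓗 i) × S × A => Q p.1 k p.2.1 p.2.2
  measurable_act : ∀ k, Measurable fun p : (∀ i, 𝓗 i) × S => act p.1 k p.2
  greedy : ∀ f, ∀ k < H, ∀ x a, Q f k x a ≤ Q f k x (act f k x)
  integrable_initial : ∀ f, Integrable (fun x => Q f 0 x (act f 0 x)) M.ρ

section Class

variable {S A : Type*} [MeasurableSpace S] [MeasurableSpace A] {H : ℕ} {M : MDP S A H}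
  {𝓗 : Fin (H + 1) → Type*} [∀ i, MeasurableSpace (𝓗 i)] (F : HypothesisClass M 𝓗)

/-- `V_{k,f}(x) = max_a Q_{k,f}(x, a)`. -/
def HypothesisClass.stateV (f : ∀ i, 𝓗 i) (k : ℕ) (x : S) : ℝ := F.Q f k x (F.act f k x)

/-- `V_f`, the value that `f` predicts for the initial state: `V_{1,f}(x_1)` for a fixed initial
state, its mean for a random one. -/
def HypothesisClass.predValue (f : ∀ i, 𝓗 i) : ℝ := ∫ x, F.stateV f 0 x ∂M.ρ

/-- `π_f`, the greedy policy of `f`. -/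
def HypothesisClass.greedyPolicy (f : ∀ i, 𝓗 i) : Policy S A :=
  Policy.ofAct (F.act f) (fun k => (F.measurable_act k).comp measurable_prodMk_left)

/-- Realizability: the hypothesis `fstar` of the class carries the optimal action value function of
the MDP. -/
def HypothesisClass.Realizes (fstar : ∀ i, 𝓗 i) : Prop :=
  ∀ k < H, ∀ x a, F.Q fstar k x a = M.optQ k x a

/-- Measurability of an exploration rule `(f, h) ↦ π_exp(f, h)` in the hypothesis. -/
def MeasurableExploration (πexp : (∀ i, 𝓗 i) → Fin H → Policy S A) : Prop :=
  ∀ (h : Fin H) (k : ℕ),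
    Measurable fun p : (∀ i, 𝓗 i) × ((Fin k → S × A) × S) => (πexp p.1 h).kern k p.2

/-! ### Generalized eluder coefficient -/

/-- The burn-in cost `2 √(d H T) + ε H T`. -/
def burnIn (d : ℝ) (H T : ℕ) (ε : ℝ) : ℝ := 2 * √(d * H * T) + ε * H * T

/-- The inequality that defines the generalized eluder coefficient, for the constant `d` and all
sequences of `T` hypotheses. `ℓ f' f h (x, a)` is `ℓ_{f'}(f, ξ_h)` with `ξ_h = (x_h, a_h)`. -/
def GECBound (ℓ : (∀ i, 𝓗 i) → (∀ i, 𝓗 i) → Fin H → S × A → ℝ)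
    (πexp : (∀ i, 𝓗 i) → Fin H → Policy S A) (ε : ℝ) (T : ℕ) (d : ℝ) : Prop :=
  ∀ f : Fin T → ∀ i, 𝓗 i,
    ∑ t, (F.predValue (f t) - M.value (F.greedyPolicy (f t))) ≤
      √(d * ∑ h : Fin H, ∑ t : Fin T, ∑ s ∈ Finset.univ.filter (· < t),
          ∫ y, ℓ (f s) (f t) h (y.1, y.2.1) ∂(M.stepLaw (πexp (f s) h) h))
        + burnIn d H T ε

/-- The generalized eluder coefficient: the smallest `d ≥ 0` for which the inequality holds, and
`∞` if there is none. -/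
def GEC (ℓ : (∀ i, 𝓗 i) → (∀ i, 𝓗 i) → Fin H → S × A → ℝ)
    (πexp : (∀ i, 𝓗 i) → Fin H → Policy S A) (ε : ℝ) (T : ℕ) : ℝ≥0∞ :=
  ⨅ (d : ℝ≥0) (_ : GECBound F ℓ πexp ε T d), (d : ℝ≥0∞)

/-! ### Loss functions

`l f' h g g' (x, a, r, x')` is the loss `l_{f'}((g, g'), ζ_h)` at step `h`, where `g ∈ 𝓗_h` and
`g' ∈ 𝓗_{h+1}`. -/

/-- The type of loss functions. -/
abbrev Loss (S A : Type*) (H : ℕ) (𝓗 : Fin (H + 1) → Type*) :=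
  (∀ i, 𝓗 i) → (h : Fin H) → 𝓗 h.castSucc → 𝓗 h.succ → S × A × ℝ × S → ℝ

/-- Joint measurability of a loss function. -/
def MeasurableLoss (l : Loss S A H 𝓗) : Prop :=
  ∀ h : Fin H, Measurable fun p : (∀ i, 𝓗 i) × 𝓗 h.castSucc × 𝓗 h.succ × (S × A × ℝ × S) =>
    l p.1 h p.2.1 p.2.2.1 p.2.2.2

variable (M) in
/-- The conditional expectation `E_{x' ∼ P_h(·|x,a)} l_{f'}((g, g'), (x, a, r, x'))`, where `r` is
the reward of `(x, a)` at step `h`. -/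
def condLoss (l : Loss S A H 𝓗) (f' : ∀ i, 𝓗 i) (h : Fin H) (g : 𝓗 h.castSucc) (g' : 𝓗 h.succ)
    (xa : S × A) : ℝ :=
  ∫ x', l f' h g g' (M.zeta h (xa.1, xa.2, x')) ∂(M.P h xa)

variable (M) in
/-- The discrepancy function is the squared conditional expectation of the loss. -/
def IsDiscrepancyOf (ℓ : (∀ i, 𝓗 i) → (∀ i, 𝓗 i) → Fin H → S × A → ℝ) (l : Loss S A H 𝓗) :
    Prop :=
  ∀ f' f h xa, ℓ f' f h xa = |condLoss M l f' h (f h.castSucc) (f h.succ) xa| ^ 2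

variable (M) in
/-- Generalized completeness, with `fstar` as a fixed point of the operator. -/
def GeneralizedCompleteness (l : Loss S A H 𝓗) (fstar : ∀ i, 𝓗 i) : Prop :=
  ∃ op : (h : Fin H) → 𝓗 h.succ → 𝓗 h.castSucc,
    (∀ f' h g g' y,
      l f' h g g' (M.zeta h y) - l f' h (op h g') g' (M.zeta h y)
        = condLoss M l f' h g g' (y.1, y.2.1)) ∧
    ∀ h, op h (fstar h.succ) = fstar h.castSucc

variable (M) in
/-- The loss is bounded by `B` on all samples `ζ = (x, a, r, x')` that can occur, that is those in
which `r` is the reward of `(x, a)`. -/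
def BoundedLoss (l : Loss S A H 𝓗) (B : ℝ) : Prop :=
  ∀ f' h g g' y, |l f' h g g' (M.zeta h y)| ≤ B

/-! ### The prior-dependent quantity `κ` -/

/-- `- log p` for a probability `p`, with value `∞` at `p = 0`. -/
def negLog (p : ℝ≥0∞) : ℝ≥0∞ := if p = 0 then ⊤ else ENNReal.ofReal (-Real.log p.toReal)

variable (M) in
/-- `F_h(ε, g')`: the `g ∈ 𝓗_h` whose conditional mean loss with `g'` is at most `ε` in absolute
value, uniformly in the state, the action and `f'`. -/
def nearComplete (l : Loss S A H 𝓗) (ε : ℝ) (h : Fin H) (g' : 𝓗 h.succ) : Set (𝓗 h.castSucc) :=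
  {g | ∀ f' xa, |condLoss M l f' h g g' xa| ≤ ε}

/-- `H(ε)`: the hypotheses that are nearly as optimistic as `fstar` and have small conditional mean
losses. -/
def nearOptimal (l : Loss S A H 𝓗) (fstar : ∀ i, 𝓗 i) (ε : ℝ) : Set (∀ i, 𝓗 i) :=
  {f | F.predValue fstar - F.predValue f < ε ∧
    ∀ f' h xa, |condLoss M l f' h (f h.castSucc) (f h.succ) xa| ≤ ε}

variable (M) in
/-- `κ^c(ε) = ∑_h sup_{g'} - log p⁰_h(F_h(ε, g'))`. -/
def kappaC (l : Loss S A H 𝓗) (p0 : ∀ i, Measure (𝓗 i)) (ε : ℝ) : ℝ≥0∞ :=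
  ∑ h : Fin H, ⨆ g' : 𝓗 h.succ, negLog (p0 h.castSucc (nearComplete M l ε h g'))

/-- `κ^r(ε) = - log p⁰(H(ε))`, where `p⁰` is the product of the priors `p⁰_h`. -/
def kappaR (l : Loss S A H 𝓗) (fstar : ∀ i, 𝓗 i) (p0 : ∀ i, Measure (𝓗 i)) (ε : ℝ) : ℝ≥0∞ :=
  negLog (Measure.pi p0 (nearOptimal F l fstar ε))

/-- `κ(ε, p⁰) = max {κ^c(ε), κ^r(ε)}`. -/
def kappa (l : Loss S A H 𝓗) (fstar : ∀ i, 𝓗 i) (p0 : ∀ i, Measure (𝓗 i)) (ε : ℝ) : ℝ≥0∞ :=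
  max (kappaC M l p0 ε) (kappaR F l fstar p0 ε)

/-! ### The model-free posterior sampling algorithm -/

/-- What one iteration leaves behind: the sampled hypothesis and, for each step `h`, the observed
transition `(x_h, a_h, x_{h+1})`, which determines `ζ_h = (x_h, a_h, r_h, x_{h+1})`. -/
abbrev Record (S A : Type*) (H : ℕ) (𝓗 : Fin (H + 1) → Type*) :=
  (∀ i, 𝓗 i) × (Fin H → S × A × S)

variable (M) in
/-- The cumulative squared loss `∑_s l_{f^s}((g, g'), ζ_h^s)²` over the past iterations. -/
def sqLoss (l : Loss S A H 𝓗) {t : ℕ} (past : Fin t → Record S A H 𝓗) (h : Fin H)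
    (g : 𝓗 h.castSucc) (g' : 𝓗 h.succ) : ℝ :=
  ∑ s, l (past s).1 h g g' (M.zeta h ((past s).2 h)) ^ 2

variable (M) in
/-- The log-likelihood `L_h` of `f` after the past iterations. -/
def logLik (l : Loss S A H 𝓗) (p0 : ∀ i, Measure (𝓗 i)) (η : ℝ) {t : ℕ}
    (past : Fin t → Record S A H 𝓗) (h : Fin H) (f : ∀ i, 𝓗 i) : ℝ :=
  -η * sqLoss M l past h (f h.castSucc) (f h.succ)
    - Real.log (∫ g, Real.exp (-η * sqLoss M l past h g (f h.succ)) ∂(p0 h.castSucc))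

/-- The optimistic posterior `∝ p⁰(f) exp(γ V_f + ∑_h L_h(f))`. -/
def posterior (l : Loss S A H 𝓗) (p0 : ∀ i, Measure (𝓗 i)) (η γ : ℝ) {t : ℕ}
    (past : Fin t → Record S A H 𝓗) : Measure (∀ i, 𝓗 i) :=
  (Measure.pi p0).tilted (fun f => γ * F.predValue f + ∑ h, logLik M l p0 η past h f)

variable (M) in
/-- The law of the samples of one iteration: for each step `h`, the policy `π_exp(f, h)` is executed
in an episode of its own and its transition at step `h` is recorded. -/
def sampleLaw (πexp : (∀ i, 𝓗 i) → Fin H → Policy S A) (f : ∀ i, 𝓗 i) :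
    Measure (Fin H → S × A × S) :=
  Measure.pi (fun h => M.stepLaw (πexp f h) h)

/-- The joint law of the records of the first `t` iterations of the algorithm. -/
def runLaw (l : Loss S A H 𝓗) (πexp : (∀ i, 𝓗 i) → Fin H → Policy S A)
    (p0 : ∀ i, Measure (𝓗 i)) (η γ : ℝ) : (t : ℕ) → Measure (Fin t → Record S A H 𝓗)
  | 0 => Measure.dirac Fin.elim0
  | t + 1 => (runLaw l πexp p0 η γ t).bind fun past =>
      (posterior F l p0 η γ past).bind fun f =>
        (sampleLaw M πexp f).map fun y =>
          Fin.snoc (α := fun _ => Record S A H 𝓗) past (f, y)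

/-- The expected regret `E ∑_{t ≤ T} (V^* - V^{π^t})` of the predicted policies `π^t = π_{f^t}` over
`T` iterations. An iteration uses `H` episodes, so `H` times this number is the expected regret over
the `H T` episodes that the algorithm plays. -/
def expRegret (l : Loss S A H 𝓗) (πexp : (∀ i, 𝓗 i) → Fin H → Policy S A)
    (p0 : ∀ i, Measure (𝓗 i)) (η γ : ℝ) (T : ℕ) : ℝ :=
  ∫ ω, ∑ t, (M.optValue - M.value (F.greedyPolicy (ω t).1)) ∂(runLaw F l πexp p0 η γ T)

end Class

/-- The regret bound with complexity term `K`, for `T` iterations with summed regret `reg`, that is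
for `H * T` episodes with regret `H * reg`. First: the regret over the `H * T` episodes is at most
a constant times `B √(d H (H T) K)` plus the burn-in cost. Second: the burn-in cost can be dropped
when it is not the dominating term. Third: the same when every iteration is counted once. -/
def RegretBound (C B d K : ℝ) (H T : ℕ) (reg : ℝ) : Prop :=
  H * reg ≤ C * (B * √(d * H * (H * T) * K) + H * burnIn d H T (1 / √T)) ∧
  (H * burnIn d H T (1 / √T) ≤ B * √(d * H * (H * T) * K) →
    H * reg ≤ C * (B * √(d * H * (H * T) * K))) ∧
  (burnIn d H T (1 / √T) ≤ B * √(d * H * T * K) → reg ≤ C * (B * √(d * H * T * K)))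

end ModelFree

end

set_option linter.unusedSectionVars false

noncomputable section

namespace ModelFree

/-! Write c for the conditional mean loss of a pair (f_h, f_{h+1}) given (x_h, a_h). Realizability
gives optimism, V^* ≤ V_{f*}, so the regret of an iteration is at most (V_{f*} - V_f) + (V_f -
V^{π_f}). The eluder inequality bounds the sum of the second terms by √(dX) plus the burn-in cost,
where X adds up the means of c² for each f^t under the exploration policies of the earlier f^s, and
γ√(dX) ≤ (η/10)X + (5/2)γ²d/η. It remains to show that the posterior mean of the round loss,
γ(V_{f*} - V_f) plus η/10 times the discrepancies against the past, is of order κ up to resolution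
errors (`regret_le_sum_roundLoss`, `lintegral_roundLoss_le`).

By completeness the noise l - c is the loss of (P_h f_{h+1}, f_{h+1}) and does not involve f_h.
Hence the squared loss may be replaced by the excess l² - (l - c)² in the log-likelihood: the
difference cancels against the normalization over f_h (`logLik_eq`). The noise has conditional mean
zero, and for the chosen η the exponential moment of -η times the excess is at most exp(-(η/10) E
c²) (`integral_exp_excessLoss_le`). For every pair fixed in advance the compensated exponentials
therefore form a supermartingale along the adaptive run, and their mean stays at most one after
averaging over any law of pairs independent of the run (`lintegral_runLaw_lintegral_le_one`).

Two such averages are used. Pairs taken from one prior draw f pay for the change of measure from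
prior to posterior. Pairs (g_h, f_{h+1}) with g independent of f show that I, the prior mean of the
product Y(f) of the normalizers of the excess likelihood, has mean at most one over the run.

The change of measure is pointwise (`roundLoss_le`): the round loss is expressed through the
log-density of the posterior, and log u ≤ u - 1 turns logarithms into variables of mean at most one.
What remains is -log Y(f), at most κ plus a resolution error by the prior mass of the nearly
complete sets, and -log Z for the posterior normalizer Z. On the nearly optimal set, of mass at
least e^{-κ}, the unnormalized density is of order e^{γ V_{f*}}/Y, so Cauchy-Schwarz bounds Z·I
below by e^{γ V_{f*} - 2κ} up to resolution errors (`le_normalizer_mul`). The total is 3κ per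
iteration, and γ balances Tκ/γ against γB²d. -/

lemma integrable_of_abs_le {α : Type*} [MeasurableSpace α] {μ : Measure α} [IsFiniteMeasure μ]
    {f : α → ℝ} (hf : Measurable f) (C : ℝ) (hC : ∀ x, |f x| ≤ C) : Integrable f μ :=
  Integrable.of_bound hf.aestronglyMeasurable C (Filter.Eventually.of_forall hC)

lemma integral_mem_Icc_of_forall {α : Type*} [MeasurableSpace α] {μ : Measure α}
    [IsProbabilityMeasure μ] {f : α → ℝ} (hf : Measurable f) {a b : ℝ}
    (h : ∀ x, f x ∈ Set.Icc a b) : ∫ x, f x ∂μ ∈ Set.Icc a b := by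
  have hi : Integrable f μ := integrable_of_abs_le hf (max |a| |b|)
    fun x => abs_le_max_abs_abs (h x).1 (h x).2
  constructor
  · simpa using integral_mono (integrable_const a) hi fun x => (h x).1
  · simpa using integral_mono hi (integrable_const b) fun x => (h x).2

lemma measurable_integral_kernel {α β : Type*} [MeasurableSpace α] [MeasurableSpace β]
    (κ : Kernel α β) [IsSFiniteKernel κ] {f : α → β → ℝ} (hf : Measurable (Function.uncurry f)) :
    Measurable fun a => ∫ b, f a b ∂κ a :=
  (StronglyMeasurable.integral_kernel_prod_right (κ := κ) hf.stronglyMeasurable).measurable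

/-! ### Dynamic programming: policies greedy for `Q^*` are optimal, and `fstar` is optimistic. -/

namespace MDP

variable {S A : Type*} [MeasurableSpace S] [MeasurableSpace A] {H : ℕ} (M : MDP S A H)

instance (k : ℕ) : IsMarkovKernel (M.nextKernel k) := by
  unfold nextKernel; infer_instance

lemma measurable_snoc_const (k : ℕ) {X : Type*} [MeasurableSpace X] :
    Measurable fun p : (Fin k → X) × X => (Fin.snoc (α := fun _ => X) p.1 p.2 : Fin (k + 1) → X) := by
  refine measurable_pi_lambda _ fun i => ?_
  refine Fin.lastCases ?_ (fun j => ?_) i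
  · simpa using measurable_snd
  · simp only [Fin.snoc_castSucc]
    exact (measurable_pi_apply j).comp measurable_fst

lemma measurable_extendTraj (k : ℕ) :
    Measurable fun q : (((Fin k → S × A) × S) × A) × S =>
      ((Fin.snoc (α := fun _ => S × A) q.1.1.1 (q.1.1.2, q.1.2) : Fin (k + 1) → S × A), q.2) :=
  ((measurable_snoc_const k).comp (f := fun q : (((Fin k → S × A) × S) × A) × S =>
    (q.1.1.1, (q.1.1.2, q.1.2))) (by fun_prop)).prodMk measurable_snd

instance isProbabilityMeasure_trajLaw (π : Policy S A) (k : ℕ) :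
    IsProbabilityMeasure (M.trajLaw π k) := by
  induction k with
  | zero => exact Measure.isProbabilityMeasure_map (by fun_prop)
  | succ k ih =>
    refine Measure.isProbabilityMeasure_map (measurable_extendTraj k).aemeasurable

instance isProbabilityMeasure_stepLaw (π : Policy S A) (k : ℕ) :
    IsProbabilityMeasure (M.stepLaw π k) :=
  Measure.isProbabilityMeasure_map (by fun_prop)

lemma R_le_one {k : ℕ} (hk : k < H) (xa : S × A) : M.R k xa ≤ 1 :=
  (Finset.single_le_sum (f := fun k => M.R k xa) (fun i _ => M.R_nonneg i xa)
    (Finset.mem_range.2 hk)).trans (M.sum_R_le_one fun _ => xa)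

lemma measurable_stateValue (π : MarkovPolicy S A) (n k : ℕ) : Measurable (M.stateValue π n k) := by
  induction n generalizing k with
  | zero => exact measurable_const
  | succ n ih =>
    refine measurable_integral_kernel (π.kern k)
      (f := fun x a => M.R k (x, a) + ∫ x', M.stateValue π n (k + 1) x' ∂(M.P k (x, a))) ?_
    refine (M.measurable_R k).add ?_
    exact measurable_integral_kernel (M.P k) (f := fun _ x' => M.stateValue π n (k + 1) x')
      ((ih (k + 1)).comp measurable_snd)

lemma measurable_integrand (π : MarkovPolicy S A) (n k : ℕ) :
    Measurable fun xa => M.R k xa + ∫ x', M.stateValue π n (k + 1) x' ∂(M.P k xa) :=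
  (M.measurable_R k).add (measurable_integral_kernel (M.P k)
    (f := fun _ x' => M.stateValue π n (k + 1) x')
      ((M.measurable_stateValue π n (k + 1)).comp measurable_snd))

/-- A crude bound from rewards at most one per step. The constant is irrelevant: boundedness is only
needed for integrability. -/
lemma stateValue_mem_Icc (π : MarkovPolicy S A) (n k : ℕ) (hk : k + n ≤ H) (x : S) :
    M.stateValue π n k x ∈ Set.Icc (0 : ℝ) n := by
  induction n generalizing k x with
  | zero => simp [stateValue]
  | succ n ih =>
    refine integral_mem_Icc_of_forall
      ((M.measurable_integrand π n k).comp measurable_prodMk_left) fun a => ?_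
    have h1 := integral_mem_Icc_of_forall (μ := M.P k (x, a))
      (M.measurable_stateValue π n (k + 1)) fun x' => ih (k + 1) (by omega) x'
    have h2 := M.R_nonneg k (x, a)
    have h3 := M.R_le_one (show k < H by omega) (x, a)
    push_cast
    exact ⟨by simpa using add_nonneg h2 h1.1, by simpa [add_comm] using add_le_add h3 h1.2⟩

lemma actionValue_mem_Icc (π : MarkovPolicy S A) {k : ℕ} (hk : k < H) (x : S) (a : A) :
    M.actionValue π k x a ∈ Set.Icc (0 : ℝ) (1 + H) := by
  have h1 := integral_mem_Icc_of_forall (μ := M.P k (x, a))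
    (M.measurable_stateValue π (H - (k + 1)) (k + 1)) fun x' =>
      M.stateValue_mem_Icc π _ (k + 1) (by omega) x'
  have h2 : ((H - (k + 1) : ℕ) : ℝ) ≤ H := by exact_mod_cast Nat.sub_le _ _
  exact ⟨add_nonneg (M.R_nonneg _ _) h1.1, add_le_add (M.R_le_one hk _) (h1.2.trans h2)⟩

lemma measurable_actionValue (π : MarkovPolicy S A) (k : ℕ) :
    Measurable fun xa : S × A => M.actionValue π k xa.1 xa.2 :=
  M.measurable_integrand π (H - (k + 1)) k

lemma bddAbove_actionValue {k : ℕ} (hk : k < H) (x : S) (a : A) :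
    BddAbove (Set.range fun π : MarkovPolicy S A => M.actionValue π k x a) :=
  ⟨1 + H, by rintro _ ⟨π, rfl⟩; exact (M.actionValue_mem_Icc π hk x a).2⟩

lemma actionValue_le_optQ (π : MarkovPolicy S A) {k : ℕ} (hk : k < H) (x : S) (a : A) :
    M.actionValue π k x a ≤ M.optQ k x a :=
  le_ciSup (M.bddAbove_actionValue hk x a) π

lemma stateValue_eq (π : MarkovPolicy S A) {k : ℕ} (hk : k < H) (x : S) :
    M.stateValue π (H - k) k x = ∫ a, M.actionValue π k x a ∂(π.kern k x) := by
  obtain ⟨n, hn⟩ : ∃ n, H - k = n + 1 := ⟨H - (k + 1), by omega⟩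
  have hn' : H - (k + 1) = n := by omega
  simp only [hn, stateValue, actionValue, hn']

/-- The deterministic Markovian policy that plays `act k x`. -/
def _root_.ModelFree.MarkovPolicy.ofAct (act : ℕ → S → A) (hact : ∀ k, Measurable (act k)) :
    MarkovPolicy S A where
  kern k := Kernel.deterministic (act k) (hact k)
  markov_kern _ := inferInstance

lemma stateValue_ofAct {act : ℕ → S → A} (hact : ∀ k, Measurable (act k)) {k : ℕ} (hk : k < H)
    (x : S) : M.stateValue (MarkovPolicy.ofAct act hact) (H - k) k x
      = M.actionValue (MarkovPolicy.ofAct act hact) k x (act k x) := by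
  rw [stateValue_eq _ _ hk]
  simp only [MarkovPolicy.ofAct, Kernel.deterministic_apply]
  exact integral_dirac' _ _
    ((M.measurable_actionValue _ k).comp measurable_prodMk_left).stronglyMeasurable

/-- A policy that is greedy with respect to `Q^*` attains `Q^*`. -/
lemma actionValue_ofAct_eq_optQ {act : ℕ → S → A} (hact : ∀ k, Measurable (act k))
    (hgreedy : ∀ k < H, ∀ x a, M.optQ k x a ≤ M.optQ k x (act k x)) {k : ℕ} (hk : k < H)
    (x : S) (a : A) :
    M.actionValue (MarkovPolicy.ofAct act hact) k x a = M.optQ k x a := by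
  -- Backward induction on the number of steps to go: from step k + 1 on, the greedy policy already
  -- attains `optQ`.
  induction hn : H - k using Nat.strong_induction_on generalizing k x a with
  | _ n ih =>
  have : Nonempty (MarkovPolicy S A) := ⟨MarkovPolicy.ofAct act hact⟩
  refine le_antisymm (M.actionValue_le_optQ _ hk x a) (ciSup_le fun π => ?_)
  unfold actionValue
  have hint : ∀ π : MarkovPolicy S A, Integrable
      (fun x' => M.stateValue π (H - (k + 1)) (k + 1) x') (M.P k (x, a)) := fun π =>
    integrable_of_abs_le (M.measurable_stateValue π _ _) (H - (k + 1) : ℕ) fun x' => by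
      have := M.stateValue_mem_Icc π (H - (k + 1)) (k + 1) (by omega) x'
      rw [abs_of_nonneg this.1]; exact this.2
  refine add_le_add le_rfl (integral_mono (hint π) (hint _) fun x' => ?_)
  -- After the final step no reward is left and both values are zero.
  rcases (show k + 1 ≤ H from hk).eq_or_lt with h | h
  · simp [h, stateValue]
  · rw [stateValue_ofAct _ _ h, ih (H - (k + 1)) (by omega) h _ _ rfl, stateValue_eq _ _ h]
    calc ∫ a, M.actionValue π (k + 1) x' a ∂(π.kern (k + 1) x')
        ≤ ∫ a, M.optQ (k + 1) x' (act (k + 1) x') ∂(π.kern (k + 1) x') := by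
          refine integral_mono (integrable_of_abs_le
            ((M.measurable_actionValue π (k + 1)).comp measurable_prodMk_left) (1 + H)
              fun a => ?_) (integrable_const _) fun a => ?_
          · have := M.actionValue_mem_Icc π h x' a
            exact (abs_of_nonneg this.1).trans_le this.2
          · exact (M.actionValue_le_optQ π h x' a).trans (hgreedy _ h x' a)
      _ = _ := by simp

/-- The tower property for one more step of an episode, in the form needed to compare consecutive
potentials in `value_le_of_greedy`. -/
lemma integral_trajLaw_succ (π : Policy S A) (k : ℕ) {G : (Fin (k + 1) → S × A) × S → ℝ}
    (hG : Measurable G) {C : ℝ} (hC : ∀ p, |G p| ≤ C) :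
    ∫ p, G p ∂(M.trajLaw π (k + 1)) =
      ∫ p, ∫ a, ∫ x', G (Fin.snoc (α := fun _ => S × A) p.1 (p.2, a), x') ∂(M.P k (p.2, a))
        ∂(π.kern k p) ∂(M.trajLaw π k) := by
  have hm := measurable_extendTraj (S := S) (A := A) k
  have hG' : Measurable fun q : (((Fin k → S × A) × S) × A) × S =>
      G (Fin.snoc (α := fun _ => S × A) q.1.1.1 (q.1.1.2, q.1.2), q.2) := hG.comp hm
  have hI : Measurable fun q => ∫ x', G (Fin.snoc (α := fun _ => S × A) q.1.1 (q.1.2, q.2), x')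
      ∂(M.nextKernel k q) :=
    measurable_integral_kernel (M.nextKernel k)
      (f := fun q x' => G (Fin.snoc (α := fun _ => S × A) q.1.1 (q.1.2, q.2), x')) hG'
  rw [trajLaw, integral_map hm.aemeasurable hG.aestronglyMeasurable,
    Measure.integral_compProd (integrable_of_abs_le hG' C fun q => hC _),
    Measure.integral_compProd (integrable_of_abs_le hI C fun q => abs_le.2
      (integral_mem_Icc_of_forall (hG'.comp measurable_prodMk_left) fun x' => abs_le.1 (hC _)))]
  rfl

lemma value_mem_Icc (π : Policy S A) : M.value π ∈ Set.Icc (0 : ℝ) 1 := by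
  have : M.value π = ∫ τ, ∑ k : Fin H, M.R k (τ.1 k) ∂(M.trajLaw π H) := rfl
  rw [this]
  refine integral_mem_Icc_of_forall ?_ fun τ => ⟨Finset.sum_nonneg fun k _ => M.R_nonneg _ _, ?_⟩
  · exact Finset.measurable_fun_sum _ fun k _ =>
      (M.measurable_R k).comp ((measurable_pi_apply k).comp measurable_fst)
  · rcases Nat.eq_zero_or_pos H with h | h
    · subst h; simp
    · have := M.sum_R_le_one fun k => if hk : k < H then τ.1 ⟨k, hk⟩ else τ.1 ⟨0, h⟩
      rw [Finset.sum_range] at this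
      simpa using this

/-- No history-dependent policy does better than the greedy policy for `Q^*`. -/
lemma value_le_of_greedy {act : ℕ → S → A} (hact : ∀ k, Measurable (act k))
    (hgreedy : ∀ k < H, ∀ x a, M.optQ k x a ≤ M.optQ k x (act k x)) (π : Policy S A) :
    M.value π ≤ ∫ x, M.stateValue (MarkovPolicy.ofAct act hact) H 0 x ∂M.ρ := by
  set V : (k : ℕ) → S → ℝ := fun k => M.stateValue (MarkovPolicy.ofAct act hact) (H - k) k with hV
  have hVm : ∀ k, Measurable (V k) := fun k => M.measurable_stateValue _ _ _
  have hVb : ∀ k ≤ H, ∀ x, V k x ∈ Set.Icc (0 : ℝ) H := fun k hk x =>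
    have := M.stateValue_mem_Icc (MarkovPolicy.ofAct act hact) (H - k) k (by omega) x
    ⟨this.1, this.2.trans (by exact_mod_cast Nat.sub_le _ _)⟩
  -- Potential: reward collected so far plus greedy value to go. It is a supermartingale under every
  -- history-dependent policy; at time 0 its mean is the greedy value, at time H it is the value of
  -- `π`.
  set G : (k : ℕ) → (Fin k → S × A) × S → ℝ := fun k p => ∑ j : Fin k, M.R j (p.1 j) + V k p.2
    with hG
  have hGm : ∀ k, Measurable (G k) := fun k =>
    (Finset.measurable_fun_sum Finset.univ fun (j : Fin k) _ =>
      (M.measurable_R j).comp ((measurable_pi_apply j).comp measurable_fst)).add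
        ((hVm k).comp measurable_snd)
  have hGb : ∀ k ≤ H, ∀ p, |G k p| ≤ k + H := fun k hk p => by
    have h1 : 0 ≤ ∑ j : Fin k, M.R j (p.1 j) := Finset.sum_nonneg fun j _ => M.R_nonneg _ _
    have h2 : ∑ j : Fin k, M.R j (p.1 j) ≤ k := by
      simpa using Finset.sum_le_sum (s := Finset.univ) fun (j : Fin k) _ =>
        M.R_le_one (j.2.trans_le hk) (p.1 j)
    have h3 := hVb k hk p.2
    rw [abs_of_nonneg (add_nonneg h1 h3.1)]
    exact add_le_add h2 h3.2
  have step : ∀ k < H, ∫ p, G (k + 1) p ∂(M.trajLaw π (k + 1)) ≤ ∫ p, G k p ∂(M.trajLaw π k) := by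
    intro k hk
    rw [M.integral_trajLaw_succ π k (hGm _) (hGb _ hk)]
    have inner : ∀ p : (Fin k → S × A) × S, ∀ a,
        ∫ x', G (k + 1) (Fin.snoc (α := fun _ => S × A) p.1 (p.2, a), x') ∂(M.P k (p.2, a))
          = ∑ j : Fin k, M.R j (p.1 j)
            + M.actionValue (MarkovPolicy.ofAct act hact) k p.2 a := by
      intro p a
      have hi : Integrable (V (k + 1)) (M.P k (p.2, a)) :=
        integrable_of_abs_le (hVm _) H fun x => by
          rw [abs_of_nonneg (hVb _ hk x).1]; exact (hVb _ hk x).2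
      simp only [hG, Fin.sum_univ_castSucc, Fin.snoc_castSucc, Fin.snoc_last, Fin.val_castSucc,
        Fin.val_last]
      rw [integral_add (integrable_const _) hi]
      simp [actionValue, hV, add_assoc]
    simp only [inner]
    have hR : Measurable fun p : (Fin k → S × A) × S => ∑ j : Fin k, M.R j (p.1 j) :=
      Finset.measurable_fun_sum _ fun j _ =>
        (M.measurable_R j).comp ((measurable_pi_apply j).comp measurable_fst)
    have hm : Measurable fun q : ((Fin k → S × A) × S) × A => ∑ j : Fin k, M.R j (q.1.1 j)
            + M.actionValue (MarkovPolicy.ofAct act hact) k q.1.2 q.2 :=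
      (hR.comp measurable_fst).add ((M.measurable_actionValue _ k).comp (by fun_prop :
          Measurable fun q : ((Fin k → S × A) × S) × A => (q.1.2, q.2)))
    have hb : ∀ (p : (Fin k → S × A) × S) a, |∑ j : Fin k, M.R j (p.1 j)
            + M.actionValue (MarkovPolicy.ofAct act hact) k p.2 a| ≤ k + (1 + H) := fun p a => by
      have h1 : 0 ≤ ∑ j : Fin k, M.R j (p.1 j) := Finset.sum_nonneg fun j _ => M.R_nonneg _ _
      have h2 : ∑ j : Fin k, M.R j (p.1 j) ≤ k := by
        simpa using Finset.sum_le_sum (s := Finset.univ) fun (j : Fin k) _ =>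
          M.R_le_one (j.2.trans hk) (p.1 j)
      have h3 := M.actionValue_mem_Icc (MarkovPolicy.ofAct act hact) hk p.2 a
      rw [abs_of_nonneg (add_nonneg h1 h3.1)]
      exact add_le_add h2 h3.2
    refine integral_mono (integrable_of_abs_le (measurable_integral_kernel (π.kern k) hm)
      (k + (1 + H)) fun p => ?_) (integrable_of_abs_le (hGm k) _ (hGb k hk.le)) fun p => ?_
    · refine abs_le.2 ?_
      exact integral_mem_Icc_of_forall (μ := π.kern k p) (hm.comp measurable_prodMk_left)
        fun a => abs_le.1 (hb p a)
    · calc ∫ a, (∑ j : Fin k, M.R j (p.1 j)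
            + M.actionValue (MarkovPolicy.ofAct act hact) k p.2 a) ∂(π.kern k p)
          ≤ ∫ a, G k p ∂(π.kern k p) := by
            refine integral_mono (integrable_of_abs_le (hm.comp measurable_prodMk_left) _ (hb p))
              (integrable_const _) fun a => ?_
            refine add_le_add le_rfl ?_
            simp only [hV]
            rw [M.stateValue_ofAct hact hk, M.actionValue_ofAct_eq_optQ hact hgreedy hk,
              M.actionValue_ofAct_eq_optQ hact hgreedy hk]
            exact hgreedy k hk _ _
        _ = G k p := by simp
  have all : ∀ k ≤ H, ∫ p, G k p ∂(M.trajLaw π k) ≤ ∫ p, G 0 p ∂(M.trajLaw π 0) := by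
    intro k
    induction k with
    | zero => exact fun _ => le_rfl
    | succ k ih => exact fun hk => (step k hk).trans (ih (by omega))
  have h0 : ∫ p, G 0 p ∂(M.trajLaw π 0) = ∫ x, V 0 x ∂M.ρ := by
    rw [trajLaw, integral_map (by fun_prop) (hGm 0).aestronglyMeasurable]
    simp [hG]
  have hH : ∫ p, G H p ∂(M.trajLaw π H) = M.value π := by
    simp [hG, hV, value, stateValue]
  have := all H le_rfl
  rw [h0, hH] at this
  exact this

end MDP

/-- Under realizability the value that `fstar` predicts is at least the optimal one. -/
lemma HypothesisClass.Realizes.optValue_le {S A : Type*} [MeasurableSpace S] [MeasurableSpace A]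
    {H : ℕ} {M : MDP S A H} {𝓗 : Fin (H + 1) → Type*} [∀ i, MeasurableSpace (𝓗 i)]
    {F : HypothesisClass M 𝓗} {fstar : ∀ i, 𝓗 i} (h : F.Realizes fstar) (hH : 0 < H) :
    M.optValue ≤ F.predValue fstar := by
  have hact : ∀ k, Measurable (F.act fstar k) := fun k =>
    (F.measurable_act k).comp measurable_prodMk_left
  have hg : ∀ k < H, ∀ x a, M.optQ k x a ≤ M.optQ k x (F.act fstar k x) := fun k hk x a => by
    rw [← h k hk, ← h k hk]; exact F.greedy _ k hk x a
  have : Nonempty (Policy S A) := ⟨F.greedyPolicy fstar⟩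
  refine ciSup_le fun π => (M.value_le_of_greedy hact hg π).trans (le_of_eq ?_)
  refine integral_congr_ae (Filter.Eventually.of_forall fun x => ?_)
  have := M.stateValue_ofAct hact hH x
  rw [Nat.sub_zero] at this
  simp only [HypothesisClass.stateV]
  rw [this, M.actionValue_ofAct_eq_optQ hact hg hH, h 0 hH]

end ModelFree

/-! ### Measurable dependence of trajectory laws and values on the hypothesis. -/

namespace ModelFree

/-- Measurability of a family of probability measures can be tested on the π-system of boxes, where
the product measure is a finite product of measurable functions. -/
lemma measurable_measurePi {Θ ι : Type*} [MeasurableSpace Θ] [Fintype ι] {X : ι → Type*}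
    [∀ i, MeasurableSpace (X i)] {μ : Θ → ∀ i, Measure (X i)}
    [∀ θ i, IsProbabilityMeasure (μ θ i)] (hμ : ∀ i, Measurable fun θ => μ θ i) :
    Measurable fun θ => Measure.pi (μ θ) := by
  refine Measurable.measure_of_isPiSystem_of_isProbabilityMeasure generateFrom_pi.symm
    isPiSystem_pi ?_
  rintro _ ⟨s, hs, rfl⟩
  simp only [Measure.pi_pi]
  exact Finset.measurable_fun_prod _ fun i _ =>
    (Measure.measurable_coe (hs i (Set.mem_univ i))).comp (hμ i)

namespace MDP

variable {S A : Type*} [MeasurableSpace S] [MeasurableSpace A] {H : ℕ} (M : MDP S A H)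

/-- For each θ the measure is the value at θ of a composition-product of kernels with source Θ, and
a kernel is measurable in its source. -/
lemma measurable_compProd_nextKernel {Θ : Type*} [MeasurableSpace Θ] {π : Θ → Policy S A} {k : ℕ}
    (hπ : Measurable fun p : Θ × ((Fin k → S × A) × S) => (π p.1).kern k p.2)
    (hτ : Measurable fun θ => M.trajLaw (π θ) k) :
    Measurable fun θ => (M.trajLaw (π θ) k ⊗ₘ (π θ).kern k) ⊗ₘ M.nextKernel k := by
  let K : Kernel Θ ((Fin k → S × A) × S) := ⟨fun θ => M.trajLaw (π θ) k, hτ⟩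
  let κ : Kernel (Θ × ((Fin k → S × A) × S)) A := ⟨_, hπ⟩
  let N : Kernel (Θ × (((Fin k → S × A) × S) × A)) S := (M.nextKernel k).comap Prod.snd measurable_snd
  have hK : IsMarkovKernel K := ⟨fun θ => M.isProbabilityMeasure_trajLaw (π θ) k⟩
  have hκ : IsMarkovKernel κ := ⟨fun p => ((π p.1).markov_kern k).isProbabilityMeasure p.2⟩
  have hN : IsMarkovKernel N := by infer_instance
  convert ((K ⊗ₖ κ) ⊗ₖ N).measurable using 2 with θ
  rw [Kernel.compProd_apply_eq_compProd_sectR, Kernel.compProd_apply_eq_compProd_sectR]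
  have h1 : Kernel.sectR κ θ = (π θ).kern k := by
    ext p : 1; rw [Kernel.sectR_apply]; rfl
  have h2 : Kernel.sectR N θ = M.nextKernel k := by
    ext p : 1; rw [Kernel.sectR_apply, Kernel.comap_apply]
  rw [h1, h2]
  rfl

lemma measurable_trajLaw {Θ : Type*} [MeasurableSpace Θ] {π : Θ → Policy S A}
    (hπ : ∀ k, Measurable fun p : Θ × ((Fin k → S × A) × S) => (π p.1).kern k p.2) (k : ℕ) :
    Measurable fun θ => M.trajLaw (π θ) k := by
  induction k with
  | zero => exact measurable_const
  | succ k ih =>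
    exact (Measure.measurable_map _ (measurable_extendTraj k)).comp
      (M.measurable_compProd_nextKernel (hπ k) ih)

lemma measurable_stepLaw {Θ : Type*} [MeasurableSpace Θ] {π : Θ → Policy S A}
    (hπ : ∀ k, Measurable fun p : Θ × ((Fin k → S × A) × S) => (π p.1).kern k p.2) (k : ℕ) :
    Measurable fun θ => M.stepLaw (π θ) k :=
  (Measure.measurable_map _ (by fun_prop)).comp
    (M.measurable_compProd_nextKernel (hπ k) (M.measurable_trajLaw hπ k))

lemma measurable_value {Θ : Type*} [MeasurableSpace Θ] {π : Θ → Policy S A}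
    (hπ : ∀ k, Measurable fun p : Θ × ((Fin k → S × A) × S) => (π p.1).kern k p.2) :
    Measurable fun θ => M.value (π θ) := by
  let K : Kernel Θ ((Fin H → S × A) × S) := ⟨fun θ => M.trajLaw (π θ) H, M.measurable_trajLaw hπ H⟩
  have hK : IsMarkovKernel K := ⟨fun θ => M.isProbabilityMeasure_trajLaw (π θ) H⟩
  exact measurable_integral_kernel K
    (f := fun _ τ => ∑ k : Fin H, M.R k (τ.1 k))
    (Finset.measurable_fun_sum _ fun k _ => (M.measurable_R k).comp
      ((measurable_pi_apply k).comp (measurable_fst.comp measurable_snd)))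

/-- The Markov property: the next state may be averaged out conditionally on (x, a). This is what
makes the noise l - c vanish in mean under any policy. -/
lemma integral_stepLaw (π : Policy S A) (k : ℕ) {G : S × A × S → ℝ} (hG : Measurable G) {C : ℝ}
    (hC : ∀ y, |G y| ≤ C) :
    ∫ y, G y ∂(M.stepLaw π k) =
      ∫ y, ∫ x', G (y.1, y.2.1, x') ∂(M.P k (y.1, y.2.1)) ∂(M.stepLaw π k) := by
  have hm : Measurable fun q : (((Fin k → S × A) × S) × A) × S => (q.1.1.2, q.1.2, q.2) := by
    fun_prop
  have hI : Measurable fun xa : S × A => ∫ x', G (xa.1, xa.2, x') ∂(M.P k xa) :=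
    measurable_integral_kernel (M.P k) (f := fun xa x' => G (xa.1, xa.2, x'))
      (hG.comp (by fun_prop : Measurable fun p : (S × A) × S => (p.1.1, p.1.2, p.2)))
  have hI' : Measurable fun y : S × A × S => ∫ x', G (y.1, y.2.1, x') ∂(M.P k (y.1, y.2.1)) :=
    hI.comp (f := fun y : S × A × S => (y.1, y.2.1)) (by fun_prop)
  have hb : ∀ xa : S × A, |∫ x', G (xa.1, xa.2, x') ∂(M.P k xa)| ≤ C := fun xa => abs_le.2
    (integral_mem_Icc_of_forall (hG.comp (by fun_prop)) fun x' => abs_le.1 (hC _))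
  have hGm : Measurable fun q : (((Fin k → S × A) × S) × A) × S => G (q.1.1.2, q.1.2, q.2) :=
    hG.comp hm
  have hIm : Measurable fun q : (((Fin k → S × A) × S) × A) × S =>
    ∫ x', G (q.1.1.2, q.1.2, x') ∂(M.P k (q.1.1.2, q.1.2)) := hI'.comp hm
  rw [stepLaw, integral_map hm.aemeasurable hG.aestronglyMeasurable,
    integral_map hm.aemeasurable hI'.aestronglyMeasurable,
    Measure.integral_compProd (integrable_of_abs_le hGm C fun q => hC _),
    Measure.integral_compProd (integrable_of_abs_le hIm C fun q => hb _)]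
  simp [nextKernel]

end MDP

section Class

variable {S A : Type*} [MeasurableSpace S] [MeasurableSpace A] {H : ℕ} {M : MDP S A H}
  {𝓗 : Fin (H + 1) → Type*} [∀ i, MeasurableSpace (𝓗 i)] (F : HypothesisClass M 𝓗)

lemma HypothesisClass.measurable_predValue : Measurable F.predValue := by
  have h : Measurable fun p : (∀ i, 𝓗 i) × S => F.stateV p.1 0 p.2 :=
    (F.measurable_Q 0).comp (measurable_fst.prodMk (measurable_snd.prodMk (F.measurable_act 0)))
  exact (StronglyMeasurable.integral_prod_right (ν := M.ρ) h.stronglyMeasurable).measurable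

lemma HypothesisClass.measurable_value_greedyPolicy :
    Measurable fun f => M.value (F.greedyPolicy f) := by
  refine M.measurable_value fun k => ?_
  simp only [greedyPolicy, Policy.ofAct, Kernel.deterministic_apply]
  exact Measure.measurable_dirac.comp ((F.measurable_act k).comp
    (measurable_fst.prodMk (measurable_snd.comp measurable_snd)))

instance (πexp : (∀ i, 𝓗 i) → Fin H → Policy S A) (f : ∀ i, 𝓗 i) :
    IsProbabilityMeasure (sampleLaw M πexp f) := by
  unfold sampleLaw; infer_instance

lemma MeasurableExploration.measurable_stepLaw {πexp : (∀ i, 𝓗 i) → Fin H → Policy S A}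
    (hπ : MeasurableExploration πexp) (h : Fin H) :
    Measurable fun f => M.stepLaw (πexp f h) h :=
  M.measurable_stepLaw (π := fun f => πexp f h) (fun k => hπ h k) h

lemma MeasurableExploration.measurable_sampleLaw {πexp : (∀ i, 𝓗 i) → Fin H → Policy S A}
    (hπ : MeasurableExploration πexp) : Measurable (sampleLaw M πexp) :=
  measurable_measurePi fun h => hπ.measurable_stepLaw h

end Class

end ModelFree

/-! ### Excess losses and their exponential moments. -/

namespace ModelFree

/-- The interval is the range of -η(c² + 2cξ) for |c|, |ξ| ≤ B and ηB² = 0.3. The coefficient 0.6 in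
place of 1/2 absorbs the Taylor terms of order three and higher. -/
lemma exp_le_one_add_add_sq {u : ℝ} (h1 : -0.9 ≤ u) (h2 : u ≤ 0.3) :
    Real.exp u ≤ 1 + u + 0.6 * u ^ 2 := by
  have hu : |u| ≤ 1 := abs_le.2 ⟨by linarith, by linarith⟩
  have h := (abs_le.1 (Real.exp_bound hu (n := 4) (by norm_num))).2
  have h4 : |u| ^ 4 = u ^ 4 := by
    rw [show (4 : ℕ) = 2 * 2 from rfl, pow_mul, pow_mul, sq_abs]
  rw [h4] at h
  norm_num [Finset.sum_range_succ, Nat.factorial] at h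
  nlinarith [mul_nonneg (sq_nonneg u) (sub_nonneg.2 h2),
    mul_nonneg (mul_nonneg (sq_nonneg u) (sub_nonneg.2 h2)) (by linarith : (0 : ℝ) ≤ u + 0.9),
    sq_nonneg u]

/-- With u = -η(c² + 2cξ), the terms linear in ξ are kept because they integrate to zero. The rest
of 0.6u² is 0.6η²(c⁴ + 4c²ξ²) ≤ 3η²B²c² = 0.9ηc², which leaves the fraction 1/10 of -ηc². -/
lemma exp_neg_excess_le {B η c ξ : ℝ} (hB : 0 < B) (hη : η = 3 / (10 * B ^ 2)) (hc : |c| ≤ B)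
    (hξ : |ξ| ≤ B) :
    Real.exp (-η * ((c + ξ) ^ 2 - ξ ^ 2)) ≤
      1 - η / 10 * c ^ 2 + ξ * (-2 * η * c + 2.4 * η ^ 2 * c ^ 3) := by
  have hη0 : 0 < η := by rw [hη]; positivity
  have hηB : η * B ^ 2 = 0.3 := by rw [hη]; field_simp; norm_num
  have hc2 : c ^ 2 ≤ B ^ 2 := sq_le_sq' (by linarith [(abs_le.1 hc).1]) (abs_le.1 hc).2
  have hξ2 : ξ ^ 2 ≤ B ^ 2 := sq_le_sq' (by linarith [(abs_le.1 hξ).1]) (abs_le.1 hξ).2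
  have hs2 : (c + ξ) ^ 2 ≤ (2 * B) ^ 2 := sq_le_sq'
    (by linarith [(abs_le.1 hξ).1, (abs_le.1 hc).1]) (by linarith [(abs_le.1 hξ).2, (abs_le.1 hc).2])
  have hD : (c + ξ) ^ 2 - ξ ^ 2 ≤ 3 * B ^ 2 := by
    have : c * ξ ≤ B ^ 2 := by nlinarith [sq_nonneg (c - ξ)]
    nlinarith
  refine (exp_le_one_add_add_sq ?_ ?_).trans ?_
  · nlinarith
  · nlinarith [sq_nonneg (c + ξ), mul_nonneg hη0.le (sq_nonneg (c + ξ))]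
  · have h1 : c ^ 4 ≤ B ^ 2 * c ^ 2 := by nlinarith [sq_nonneg c]
    have h2 : c ^ 2 * ξ ^ 2 ≤ B ^ 2 * c ^ 2 := by nlinarith [sq_nonneg c]
    have h3 : η ^ 2 * (c ^ 4 + 4 * (c ^ 2 * ξ ^ 2)) ≤ η ^ 2 * (5 * (B ^ 2 * c ^ 2)) :=
      mul_le_mul_of_nonneg_left (by linarith) (sq_nonneg _)
    have h4 : η ^ 2 * (5 * (B ^ 2 * c ^ 2)) = 1.5 * η * c ^ 2 := by
      linear_combination (5 * η * c ^ 2) * hηB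
    nlinarith

section Class

variable {S A : Type*} [MeasurableSpace S] [MeasurableSpace A] {H : ℕ} {M : MDP S A H}
  {𝓗 : Fin (H + 1) → Type*} [∀ i, MeasurableSpace (𝓗 i)]

lemma measurable_zeta (k : ℕ) : Measurable (M.zeta k) := by
  have := M.measurable_R k
  unfold MDP.zeta
  fun_prop

variable (M) in
/-- The excess of the squared loss of `(g, g')` over its conditional variance. -/
def excessLoss (l : Loss S A H 𝓗) (f' : ∀ i, 𝓗 i) (h : Fin H) (g : 𝓗 h.castSucc) (g' : 𝓗 h.succ)
    (y : S × A × S) : ℝ :=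
  l f' h g g' (M.zeta h y) ^ 2
    - (l f' h g g' (M.zeta h y) - condLoss M l f' h g g' (y.1, y.2.1)) ^ 2

variable (M) in
/-- The mean discrepancy of `(g, g')` relative to `f'` under the exploration policy of `f'`. -/
def meanDiscrepancy (l : Loss S A H 𝓗) (πexp : (∀ i, 𝓗 i) → Fin H → Policy S A) (f' : ∀ i, 𝓗 i)
    (h : Fin H) (g : 𝓗 h.castSucc) (g' : 𝓗 h.succ) : ℝ :=
  ∫ y, condLoss M l f' h g g' (y.1, y.2.1) ^ 2 ∂(M.stepLaw (πexp f' h) h)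

lemma meanDiscrepancy_nonneg (l : Loss S A H 𝓗) (πexp : (∀ i, 𝓗 i) → Fin H → Policy S A)
    (f' : ∀ i, 𝓗 i) (h : Fin H) (g : 𝓗 h.castSucc) (g' : 𝓗 h.succ) :
    0 ≤ meanDiscrepancy M l πexp f' h g g' :=
  integral_nonneg fun _ => sq_nonneg _

variable {l : Loss S A H 𝓗}

lemma MeasurableLoss.zeta (hl : MeasurableLoss l) (h : Fin H) :
    Measurable fun p : (∀ i, 𝓗 i) × 𝓗 h.castSucc × 𝓗 h.succ × (S × A × S) =>
      l p.1 h p.2.1 p.2.2.1 (M.zeta h p.2.2.2) := by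
  have := measurable_zeta (M := M) h
  exact (hl h).comp (f := fun p : (∀ i, 𝓗 i) × 𝓗 h.castSucc × 𝓗 h.succ × (S × A × S) =>
    (p.1, p.2.1, p.2.2.1, M.zeta h p.2.2.2)) (by fun_prop)

lemma MeasurableLoss.condLoss (hl : MeasurableLoss l) (h : Fin H) :
    Measurable fun p : (∀ i, 𝓗 i) × 𝓗 h.castSucc × 𝓗 h.succ × (S × A) =>
      condLoss M l p.1 h p.2.1 p.2.2.1 p.2.2.2 := by
  refine measurable_integral_kernel
    ((M.P h).comap (fun p : (∀ i, 𝓗 i) × 𝓗 h.castSucc × 𝓗 h.succ × (S × A) => p.2.2.2)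
      (by fun_prop))
    (f := fun p x' => l p.1 h p.2.1 p.2.2.1 (M.zeta h (p.2.2.2.1, p.2.2.2.2, x'))) ?_
  exact (hl.zeta h).comp
    (f := fun p : ((∀ i, 𝓗 i) × 𝓗 h.castSucc × 𝓗 h.succ × (S × A)) × S =>
      (p.1.1, p.1.2.1, p.1.2.2.1, (p.1.2.2.2.1, p.1.2.2.2.2, p.2))) (by fun_prop)

lemma MeasurableLoss.condLoss_obs (hl : MeasurableLoss l) (h : Fin H) :
    Measurable fun p : (∀ i, 𝓗 i) × 𝓗 h.castSucc × 𝓗 h.succ × (S × A × S) =>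
      ModelFree.condLoss M l p.1 h p.2.1 p.2.2.1 (p.2.2.2.1, p.2.2.2.2.1) :=
  (hl.condLoss h).comp (f := fun p : (∀ i, 𝓗 i) × 𝓗 h.castSucc × 𝓗 h.succ × (S × A × S) =>
    (p.1, p.2.1, p.2.2.1, (p.2.2.2.1, p.2.2.2.2.1))) (by fun_prop)

lemma MeasurableLoss.excessLoss (hl : MeasurableLoss l) (h : Fin H) :
    Measurable fun p : (∀ i, 𝓗 i) × 𝓗 h.castSucc × 𝓗 h.succ × (S × A × S) =>
      excessLoss M l p.1 h p.2.1 p.2.2.1 p.2.2.2 :=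
  ((hl.zeta h).pow_const 2).sub (((hl.zeta h).sub (hl.condLoss_obs h)).pow_const 2)

lemma MeasurableLoss.meanDiscrepancy (hl : MeasurableLoss l)
    {πexp : (∀ i, 𝓗 i) → Fin H → Policy S A} (hπ : MeasurableExploration πexp) (h : Fin H) :
    Measurable fun p : (∀ i, 𝓗 i) × 𝓗 h.castSucc × 𝓗 h.succ =>
      meanDiscrepancy M l πexp p.1 h p.2.1 p.2.2 := by
  let κ : Kernel ((∀ i, 𝓗 i) × 𝓗 h.castSucc × 𝓗 h.succ) (S × A × S) :=
    ⟨fun p => M.stepLaw (πexp p.1 h) h, (hπ.measurable_stepLaw h).comp measurable_fst⟩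
  have hκ : IsMarkovKernel κ := ⟨fun p => M.isProbabilityMeasure_stepLaw _ _⟩
  refine measurable_integral_kernel κ
    (f := fun p y => ModelFree.condLoss M l p.1 h p.2.1 p.2.2 (y.1, y.2.1) ^ 2) ?_
  exact ((hl.condLoss_obs h).comp
    (f := fun p : ((∀ i, 𝓗 i) × 𝓗 h.castSucc × 𝓗 h.succ) × (S × A × S) =>
      (p.1.1, p.1.2.1, p.1.2.2, p.2)) (by fun_prop)).pow_const 2

variable {B : ℝ}

lemma BoundedLoss.condLoss (hB : BoundedLoss M l B) (hl : MeasurableLoss l) (f' : ∀ i, 𝓗 i)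
    (h : Fin H) (g : 𝓗 h.castSucc) (g' : 𝓗 h.succ) (xa : S × A) :
    |condLoss M l f' h g g' xa| ≤ B :=
  abs_le.2 (integral_mem_Icc_of_forall
    ((hl.zeta h).comp (f := fun x' => (f', g, g', (xa.1, xa.2, x'))) (by fun_prop))
    fun _ => abs_le.1 (hB _ _ _ _ _))

/-- The centred loss is itself a loss, that of (P_h g', g'), so it obeys the same bound B instead of
2B. -/
lemma GeneralizedCompleteness.abs_sub_condLoss_le {fstar : ∀ i, 𝓗 i}
    (hc : GeneralizedCompleteness M l fstar) (hB : BoundedLoss M l B) (f' : ∀ i, 𝓗 i)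
    (h : Fin H) (g : 𝓗 h.castSucc) (g' : 𝓗 h.succ) (y : S × A × S) :
    |l f' h g g' (M.zeta h y) - condLoss M l f' h g g' (y.1, y.2.1)| ≤ B := by
  obtain ⟨op, h1, -⟩ := hc
  rw [← h1, sub_sub_cancel]
  exact hB _ _ _ _ _

/-- The squared loss is the excess loss plus a term that does not depend on `g`. -/
lemma GeneralizedCompleteness.exists_sq_eq {fstar : ∀ i, 𝓗 i}
    (hc : GeneralizedCompleteness M l fstar) (h : Fin H) (g' : 𝓗 h.succ) :
    ∃ g₀ : 𝓗 h.castSucc, ∀ f' g y, l f' h g g' (M.zeta h y) ^ 2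
      = excessLoss M l f' h g g' y + l f' h g₀ g' (M.zeta h y) ^ 2 := by
  obtain ⟨op, h1, -⟩ := hc
  refine ⟨op h g', fun f' g y => ?_⟩
  rw [excessLoss, ← h1]
  ring

lemma meanDiscrepancy_le (hB : BoundedLoss M l B) (hl : MeasurableLoss l)
    (πexp : (∀ i, 𝓗 i) → Fin H → Policy S A) (f' : ∀ i, 𝓗 i)
    (h : Fin H) (g : 𝓗 h.castSucc) (g' : 𝓗 h.succ) :
    meanDiscrepancy M l πexp f' h g g' ≤ B ^ 2 := by
  refine (integral_mem_Icc_of_forall (a := 0) (b := B ^ 2) ?_ fun y => ⟨sq_nonneg _, ?_⟩).2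
  · exact ((hl.condLoss_obs h).comp (f := fun y => (f', g, g', y)) (by fun_prop)).pow_const 2
  · have := hB.condLoss hl f' h g g' (y.1, y.2.1)
    rw [← sq_abs]
    exact pow_le_pow_left₀ (abs_nonneg _) this 2

/-- The excess factors as (l + (l - c))·c, so it is linear in c. Hypotheses with conditional mean
losses at most ε thus lose only O(Bε) per sample in the likelihood. -/
lemma abs_excessLoss_le {fstar : ∀ i, 𝓗 i} (hc : GeneralizedCompleteness M l fstar)
    (hB : BoundedLoss M l B) (hl : MeasurableLoss l) {f' : ∀ i, 𝓗 i}
    {h : Fin H} {g : 𝓗 h.castSucc} {g' : 𝓗 h.succ} {y : S × A × S} {ε : ℝ}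
    (hε : |condLoss M l f' h g g' (y.1, y.2.1)| ≤ ε) :
    |excessLoss M l f' h g g' y| ≤ 3 * B * ε := by
  have h1 := hB.condLoss hl f' h g g' (y.1, y.2.1)
  have h2 := hc.abs_sub_condLoss_le hB f' h g g' y
  have h3 := hB f' h g g' y
  unfold excessLoss
  set c := condLoss M l f' h g g' (y.1, y.2.1)
  set L := l f' h g g' (M.zeta h y)
  have e : L ^ 2 - (L - c) ^ 2 = (L + (L - c)) * c := by ring
  have h0 : |L + (L - c)| ≤ 3 * B := by
    refine (abs_add_le _ _).trans ?_
    linarith [abs_nonneg (L - c)]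
  rw [e, abs_mul]
  exact mul_le_mul h0 hε (abs_nonneg _) ((abs_nonneg _).trans h0)

lemma abs_excessLoss_le_sq {fstar : ∀ i, 𝓗 i} (hc : GeneralizedCompleteness M l fstar)
    (hB : BoundedLoss M l B) (hl : MeasurableLoss l) (f' : ∀ i, 𝓗 i)
    (h : Fin H) (g : 𝓗 h.castSucc) (g' : 𝓗 h.succ) (y : S × A × S) :
    |excessLoss M l f' h g g' y| ≤ 3 * B * B :=
  abs_excessLoss_le hc hB hl (hB.condLoss hl f' h g g' (y.1, y.2.1))

/-- The exponential moment of the excess loss decays with the mean discrepancy. -/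
lemma integral_exp_excessLoss_le {fstar : ∀ i, 𝓗 i} {η : ℝ}
    (hc : GeneralizedCompleteness M l fstar) (hB0 : 0 < B) (hB : BoundedLoss M l B)
    (hl : MeasurableLoss l) (hη : η = 3 / (10 * B ^ 2)) (π : Policy S A) (f' : ∀ i, 𝓗 i)
    (h : Fin H) (g : 𝓗 h.castSucc) (g' : 𝓗 h.succ) :
    ∫ y, Real.exp (-η * excessLoss M l f' h g g' y) ∂(M.stepLaw π h)
      ≤ Real.exp (-(η / 10 * ∫ y, condLoss M l f' h g g' (y.1, y.2.1) ^ 2 ∂(M.stepLaw π h))) := by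
  set c : S × A × S → ℝ := fun y => condLoss M l f' h g g' (y.1, y.2.1) with hcdef
  set L : S × A × S → ℝ := fun y => l f' h g g' (M.zeta h y) with hLdef
  set w : S × A × S → ℝ := fun y => -2 * η * c y + 2.4 * η ^ 2 * c y ^ 3 with hw
  have hη0 : 0 < η := by rw [hη]; positivity
  have hcm : Measurable c := (hl.condLoss_obs h).comp (f := fun y => (f', g, g', y)) (by fun_prop)
  have hLm : Measurable L := (hl.zeta h).comp (f := fun y => (f', g, g', y)) (by fun_prop)
  have hcb : ∀ y, |c y| ≤ B := fun y => hB.condLoss hl _ _ _ _ _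
  have hξb : ∀ y, |L y - c y| ≤ B := fun y => hc.abs_sub_condLoss_le hB _ _ _ _ _
  have hwm : Measurable w := by fun_prop
  have hwb : ∀ y, |w y| ≤ 2 * η * B + 2.4 * η ^ 2 * B ^ 3 := fun y => by
    refine (abs_add_le _ _).trans (add_le_add ?_ ?_)
    · rw [abs_mul, abs_of_neg (by linarith : -2 * η < 0)]
      nlinarith [hcb y]
    · rw [abs_mul, abs_of_pos (by positivity : 0 < 2.4 * η ^ 2), abs_pow]
      have := pow_le_pow_left₀ (abs_nonneg _) (hcb y) 3
      gcongr
  have hξw : ∀ y, |(L y - c y) * w y| ≤ B * (2 * η * B + 2.4 * η ^ 2 * B ^ 3) := fun y => by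
    rw [abs_mul]
    exact mul_le_mul (hξb y) (hwb y) (abs_nonneg _) hB0.le
  have hξwm : Measurable fun y => (L y - c y) * w y := by fun_prop
  have hc2 : ∀ y, |c y ^ 2| ≤ B ^ 2 := fun y => by
    rw [abs_pow]; exact pow_le_pow_left₀ (abs_nonneg _) (hcb y) 2
  have hc2i : Integrable (fun y => c y ^ 2) (M.stepLaw π h) :=
    integrable_of_abs_le (hcm.pow_const 2) _ hc2
  -- Given (x, a), the noise `L - c` has mean zero, while the weight `w` is a function of (x, a)
  -- alone.
  have zero : ∫ y, (L y - c y) * w y ∂(M.stepLaw π h) = 0 := by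
    rw [M.integral_stepLaw π h hξwm hξw]
    refine integral_eq_zero_of_ae (Filter.Eventually.of_forall fun y => ?_)
    have hLi : Integrable (fun x' => L (y.1, y.2.1, x')) (M.P h (y.1, y.2.1)) :=
      integrable_of_abs_le (hLm.comp (by fun_prop)) B fun _ => hB _ _ _ _ _
    have : ∫ x', (L (y.1, y.2.1, x') - c y) * w y ∂(M.P h (y.1, y.2.1)) = 0 := by
      rw [integral_mul_const, integral_sub hLi (integrable_const _)]
      simp only [integral_const, probReal_univ, one_smul]
      rw [show ∫ x', L (y.1, y.2.1, x') ∂(M.P h (y.1, y.2.1)) = c y from rfl]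
      simp
    exact this
  have hpt : ∀ y, Real.exp (-η * excessLoss M l f' h g g' y)
      ≤ 1 - η / 10 * c y ^ 2 + (L y - c y) * w y := fun y => by
    have := exp_neg_excess_le hB0 hη (hcb y) (hξb y)
    rw [add_sub_cancel] at this
    exact this
  have hem : Measurable fun y => Real.exp (-η * excessLoss M l f' h g g' y) :=
    (((hl.excessLoss h).comp (f := fun y => (f', g, g', y)) (by fun_prop)).const_mul _).exp
  have hleft : Integrable (fun y => 1 - η / 10 * c y ^ 2) (M.stepLaw π h) :=
    (integrable_const _).sub (hc2i.const_mul _)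
  have hright : Integrable (fun y => 1 - η / 10 * c y ^ 2 + (L y - c y) * w y)
      (M.stepLaw π h) :=
    hleft.add (integrable_of_abs_le hξwm _ hξw)
  calc ∫ y, Real.exp (-η * excessLoss M l f' h g g' y) ∂(M.stepLaw π h)
      ≤ ∫ y, (1 - η / 10 * c y ^ 2 + (L y - c y) * w y) ∂(M.stepLaw π h) :=
        integral_mono (Integrable.mono' hright hem.aestronglyMeasurable
          (Filter.Eventually.of_forall fun y => by
            rw [Real.norm_of_nonneg (Real.exp_pos _).le]; exact hpt y)) hright hpt
    _ = 1 - η / 10 * ∫ y, c y ^ 2 ∂(M.stepLaw π h) := by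
        rw [integral_add hleft (integrable_of_abs_le hξwm _ hξw), zero, integral_sub (integrable_const _)
          (hc2i.const_mul _), integral_const_mul]
        simp
    _ ≤ _ := by
        have := Real.add_one_le_exp (-(η / 10 * ∫ y, c y ^ 2 ∂(M.stepLaw π h)))
        linarith

end Class

end ModelFree

/-! ### The posterior and the law of the run. -/

namespace ModelFree

lemma measurable_tilted {α β : Type*} [MeasurableSpace α] [MeasurableSpace β] {μ : Measure β}
    [SFinite μ] {g : α → β → ℝ} (hg : Measurable (Function.uncurry g)) :
    Measurable fun a => μ.tilted (g a) := by
  refine Measure.measurable_of_measurable_coe _ fun s hs => ?_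
  have hZ : Measurable fun a => ∫ b, Real.exp (g a b) ∂μ :=
    (StronglyMeasurable.integral_prod_right' (ν := μ)
      (f := fun p : α × β => Real.exp (g p.1 p.2)) hg.exp.stronglyMeasurable).measurable
  simp only [tilted_apply' _ _ hs]
  exact Measurable.lintegral_prod_right' (ν := μ.restrict s)
    (f := fun p : α × β => ENNReal.ofReal (Real.exp (g p.1 p.2) / ∫ b, Real.exp (g p.1 b) ∂μ))
    (hg.exp.div (hZ.comp measurable_fst)).ennreal_ofReal

/-- Independence of the coordinates. It serves both the separate exploration episodes of an
iteration and independent prior draws g_h. -/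
lemma lintegral_pi_prod {ι : Type*} [Fintype ι] {X : ι → Type*} [∀ i, MeasurableSpace (X i)]
    (μ : ∀ i, Measure (X i)) [∀ i, IsProbabilityMeasure (μ i)] {f : ∀ i, X i → ℝ≥0∞}
    (hf : ∀ i, Measurable (f i)) :
    ∫⁻ x, ∏ i, f i (x i) ∂(Measure.pi μ) = ∏ i, ∫⁻ x, f i x ∂(μ i) := by
  refine (lintegral_prod_eq_prod_lintegral_of_indepFun Finset.univ (fun i (x : ∀ i, X i) => f i (x i))
    (iIndepFun_pi fun i => (hf i).aemeasurable)
    fun i => (hf i).comp (measurable_pi_apply i)).trans ?_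
  refine Finset.prod_congr rfl fun i _ => ?_
  exact (measurePreserving_eval μ i).lintegral_comp (hf i)

section Class

variable {S A : Type*} [MeasurableSpace S] [MeasurableSpace A] {H : ℕ} {M : MDP S A H}
  {𝓗 : Fin (H + 1) → Type*} [∀ i, MeasurableSpace (𝓗 i)] {F : HypothesisClass M 𝓗}
  {l : Loss S A H 𝓗} {πexp : (∀ i, 𝓗 i) → Fin H → Policy S A}
  {p0 : ∀ i, Measure (𝓗 i)} [∀ i, IsProbabilityMeasure (p0 i)] {η γ v B : ℝ}

lemma MeasurableLoss.sqLoss (hl : MeasurableLoss l) (t : ℕ) (h : Fin H) :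
    Measurable fun q : (Fin t → Record S A H 𝓗) × 𝓗 h.castSucc × 𝓗 h.succ =>
      sqLoss M l q.1 h q.2.1 q.2.2 := by
  refine Finset.measurable_fun_sum _ fun s _ => Measurable.pow_const ?_ 2
  exact (hl.zeta h).comp (f := fun q : (Fin t → Record S A H 𝓗) × 𝓗 h.castSucc × 𝓗 h.succ =>
    ((q.1 s).1, q.2.1, q.2.2, (q.1 s).2 h)) (by fun_prop)

lemma MeasurableLoss.logLik (hl : MeasurableLoss l) (t : ℕ) (h : Fin H) :
    Measurable fun q : (Fin t → Record S A H 𝓗) × (∀ i, 𝓗 i) =>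
      logLik M l p0 η q.1 h q.2 := by
  refine Measurable.sub (((hl.sqLoss t h).comp
    (f := fun q : (Fin t → Record S A H 𝓗) × (∀ i, 𝓗 i) => (q.1, q.2 h.castSucc, q.2 h.succ))
    (by fun_prop)).const_mul (-η)) (Measurable.log ?_)
  refine (StronglyMeasurable.integral_prod_right' (ν := p0 h.castSucc)
    (f := fun q : ((Fin t → Record S A H 𝓗) × (∀ i, 𝓗 i)) × 𝓗 h.castSucc =>
      Real.exp (-η * ModelFree.sqLoss M l q.1.1 h q.2 (q.1.2 h.succ)))
    (Measurable.stronglyMeasurable ?_)).measurable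
  exact (((hl.sqLoss t h).comp
    (f := fun q : ((Fin t → Record S A H 𝓗) × (∀ i, 𝓗 i)) × 𝓗 h.castSucc =>
      (q.1.1, q.2, q.1.2 h.succ)) (by fun_prop)).const_mul (-η)).exp

lemma sqLoss_nonneg {t : ℕ} (past : Fin t → Record S A H 𝓗) (h : Fin H)
    (g : 𝓗 h.castSucc) (g' : 𝓗 h.succ) : 0 ≤ sqLoss M l past h g g' :=
  Finset.sum_nonneg fun _ _ => sq_nonneg _

lemma sqLoss_le (hB : BoundedLoss M l B) {t : ℕ} (past : Fin t → Record S A H 𝓗) (h : Fin H)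
    (g : 𝓗 h.castSucc) (g' : 𝓗 h.succ) : sqLoss M l past h g g' ≤ t * B ^ 2 := by
  have : sqLoss M l past h g g' ≤ ∑ _s : Fin t, B ^ 2 := Finset.sum_le_sum fun s _ => by
    rw [← sq_abs]
    exact pow_le_pow_left₀ (abs_nonneg _) (hB _ _ _ _ _) 2
  simpa using this

/-- The normalizer is at least exp(-ηtB²) and the first term is at most zero. Only an upper bound is
needed: together with predicted values bounded above it makes the exponential density integrable,
and nothing bounds those values below. -/
lemma logLik_le (hB : BoundedLoss M l B) (hl : MeasurableLoss l) (hη : 0 ≤ η) {t : ℕ}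
    (past : Fin t → Record S A H 𝓗) (h : Fin H) (f : ∀ i, 𝓗 i) :
    logLik M l p0 η past h f ≤ η * (t * B ^ 2) := by
  have hm : Measurable fun g => Real.exp (-η * sqLoss M l past h g (f h.succ)) :=
    (((hl.sqLoss t h).comp (f := fun g => (past, g, f h.succ)) (by fun_prop)).const_mul (-η)).exp
  have h1 := (integral_mem_Icc_of_forall (μ := p0 h.castSucc) hm
    (a := Real.exp (-η * (t * B ^ 2))) (b := 1) fun g => ⟨?_, ?_⟩).1
  · have h2 := Real.log_le_log (Real.exp_pos _) h1
    rw [Real.log_exp] at h2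
    have h3 := mul_nonneg hη (sqLoss_nonneg (M := M) (l := l) past h (f h.castSucc) (f h.succ))
    unfold logLik
    linarith
  · refine Real.exp_le_exp.2 ?_
    nlinarith [sqLoss_le hB past h g (f h.succ)]
  · refine Real.exp_le_one_iff.2 ?_
    nlinarith [sqLoss_nonneg (M := M) (l := l) past h g (f h.succ)]

variable (F l p0 η γ) in
/-- The exponent of the density of the posterior with respect to the prior. -/
def posteriorExponent {t : ℕ} (past : Fin t → Record S A H 𝓗) (f : ∀ i, 𝓗 i) : ℝ :=
  γ * F.predValue f + ∑ h, logLik M l p0 η past h f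

lemma MeasurableLoss.posteriorExponent (hl : MeasurableLoss l) (t : ℕ) :
    Measurable fun q : (Fin t → Record S A H 𝓗) × (∀ i, 𝓗 i) =>
      posteriorExponent F l p0 η γ q.1 q.2 :=
  ((F.measurable_predValue.comp measurable_snd).const_mul γ).add
    (Finset.measurable_fun_sum _ fun h _ => hl.logLik t h)

lemma MeasurableLoss.posteriorExponent_past (hl : MeasurableLoss l) {t : ℕ}
    (past : Fin t → Record S A H 𝓗) : Measurable (ModelFree.posteriorExponent F l p0 η γ past) :=
  (hl.posteriorExponent t).comp (measurable_prodMk_left (x := past))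

lemma MeasurableLoss.posterior (hl : MeasurableLoss l) (t : ℕ) :
    Measurable fun past : Fin t → Record S A H 𝓗 => posterior F l p0 η γ past :=
  measurable_tilted (g := fun past f => ModelFree.posteriorExponent F l p0 η γ past f)
    (hl.posteriorExponent t)

lemma integrable_exp_posteriorExponent (hB : BoundedLoss M l B) (hl : MeasurableLoss l)
    (hη : 0 ≤ η) (hγ : 0 ≤ γ) (hv : ∀ f, F.predValue f ≤ v) {t : ℕ}
    (past : Fin t → Record S A H 𝓗) :
    Integrable (fun f => Real.exp (posteriorExponent F l p0 η γ past f)) (Measure.pi p0) := by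
  refine integrable_of_abs_le (hl.posteriorExponent_past past).exp
    (Real.exp (γ * v + ∑ _h : Fin H, η * (t * B ^ 2))) fun f => ?_
  rw [abs_of_pos (Real.exp_pos _)]
  exact Real.exp_le_exp.2 (add_le_add (mul_le_mul_of_nonneg_left (hv f) hγ)
    (Finset.sum_le_sum fun h _ => logLik_le hB hl hη past h f))

lemma isProbabilityMeasure_posterior (hB : BoundedLoss M l B) (hl : MeasurableLoss l)
    (hη : 0 ≤ η) (hγ : 0 ≤ γ) (hv : ∀ f, F.predValue f ≤ v) {t : ℕ}
    (past : Fin t → Record S A H 𝓗) : IsProbabilityMeasure (posterior F l p0 η γ past) :=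
  isProbabilityMeasure_tilted (integrable_exp_posteriorExponent hB hl hη hγ hv past)

/-- Joint measurability in the past and the new hypothesis: the mass of a set under the image law is
the kernel mass of a section of a jointly measurable set. -/
lemma measurable_map_snoc (hπ : MeasurableExploration πexp) (t : ℕ) :
    Measurable fun q : (Fin t → Record S A H 𝓗) × (∀ i, 𝓗 i) =>
      (sampleLaw M πexp q.2).map fun y =>
        (Fin.snoc (α := fun _ => Record S A H 𝓗) q.1 (q.2, y) : Fin (t + 1) → Record S A H 𝓗) := by
  have hs : Measurable fun q : ((Fin t → Record S A H 𝓗) × (∀ i, 𝓗 i)) × (Fin H → S × A × S) =>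
      (Fin.snoc (α := fun _ => Record S A H 𝓗) q.1.1 (q.1.2, q.2) :
        Fin (t + 1) → Record S A H 𝓗) :=
    (MDP.measurable_snoc_const t).comp
      (f := fun q : ((Fin t → Record S A H 𝓗) × (∀ i, 𝓗 i)) × (Fin H → S × A × S) =>
        (q.1.1, ((q.1.2, q.2) : Record S A H 𝓗))) (by fun_prop)
  let κ : Kernel ((Fin t → Record S A H 𝓗) × (∀ i, 𝓗 i)) (Fin H → S × A × S) :=
    ⟨fun q => sampleLaw M πexp q.2, hπ.measurable_sampleLaw.comp measurable_snd⟩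
  have hκ : IsMarkovKernel κ := ⟨fun q => inferInstanceAs (IsProbabilityMeasure (sampleLaw _ _ _))⟩
  refine Measure.measurable_of_measurable_coe _ fun s hms => ?_
  have : ∀ q : (Fin t → Record S A H 𝓗) × (∀ i, 𝓗 i), ((sampleLaw M πexp q.2).map fun y =>
      (Fin.snoc (α := fun _ => Record S A H 𝓗) q.1 (q.2, y) : Fin (t + 1) → Record S A H 𝓗)) s
      = κ q (Prod.mk q ⁻¹' ((fun q : ((Fin t → Record S A H 𝓗) × (∀ i, 𝓗 i)) ×
        (Fin H → S × A × S) => (Fin.snoc (α := fun _ => Record S A H 𝓗) q.1.1 (q.1.2, q.2) :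
        Fin (t + 1) → Record S A H 𝓗)) ⁻¹' s)) := fun q => by
    exact Measure.map_apply (hs.comp (measurable_prodMk_left (x := q))) hms
  simp only [this]
  exact Kernel.measurable_kernel_prodMk_left (hs hms)

/-- Unfolds the last iteration into past, posterior draw and samples; all expectations over the run
are computed through it. `Measure.bind` unfolds this way only for measurable families, which is what
the proof supplies. -/
lemma lintegral_runLaw_succ (hB : BoundedLoss M l B) (hl : MeasurableLoss l)
    (hπ : MeasurableExploration πexp)
    (hη : 0 ≤ η) (hγ : 0 ≤ γ) (hv : ∀ f, F.predValue f ≤ v) {t : ℕ}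
    {G : (Fin (t + 1) → Record S A H 𝓗) → ℝ≥0∞} (hG : Measurable G) :
    ∫⁻ ω, G ω ∂(runLaw F l πexp p0 η γ (t + 1)) =
      ∫⁻ past, ∫⁻ f, ∫⁻ y, G (Fin.snoc (α := fun _ => Record S A H 𝓗) past (f, y))
        ∂(sampleLaw M πexp f) ∂(posterior F l p0 η γ past) ∂(runLaw F l πexp p0 η γ t) := by
  let κ : Kernel (Fin t → Record S A H 𝓗) (∀ i, 𝓗 i) :=
    ⟨fun past => posterior F l p0 η γ past, hl.posterior t⟩
  have hκ : IsMarkovKernel κ := ⟨fun past => isProbabilityMeasure_posterior hB hl hη hγ hv past⟩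
  have hm := measurable_map_snoc (M := M) hπ t
  have hmp : ∀ past : Fin t → Record S A H 𝓗, Measurable fun f => (sampleLaw M πexp f).map fun y =>
      (Fin.snoc (α := fun _ => Record S A H 𝓗) past (f, y) : Fin (t + 1) → Record S A H 𝓗) :=
    fun past => hm.comp measurable_prodMk_left
  have hbind : Measurable fun past : Fin t → Record S A H 𝓗 =>
      (posterior F l p0 η γ past).bind fun f => (sampleLaw M πexp f).map fun y =>
      (Fin.snoc (α := fun _ => Record S A H 𝓗) past (f, y) : Fin (t + 1) → Record S A H 𝓗) := by
    refine Measure.measurable_of_measurable_coe _ fun s hs => ?_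
    have : ∀ past : Fin t → Record S A H 𝓗,
        ((posterior F l p0 η γ past).bind fun f => (sampleLaw M πexp f).map fun y =>
          (Fin.snoc (α := fun _ => Record S A H 𝓗) past (f, y) : Fin (t + 1) → Record S A H 𝓗)) s
        = ∫⁻ f, ((sampleLaw M πexp f).map fun y => (Fin.snoc (α := fun _ => Record S A H 𝓗) past
          (f, y) : Fin (t + 1) → Record S A H 𝓗)) s ∂(κ past) := fun past => by
      rw [Measure.bind_apply hs (hmp past).aemeasurable]
      rfl
    simp only [this]
    exact Measurable.lintegral_kernel_prod_right (κ := κ)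
      (f := fun past f => ((sampleLaw M πexp f).map fun y => (Fin.snoc
        (α := fun _ => Record S A H 𝓗) past (f, y) : Fin (t + 1) → Record S A H 𝓗)) s)
      ((Measure.measurable_coe hs).comp hm)
  rw [runLaw, Measure.lintegral_bind hbind.aemeasurable hG.aemeasurable]
  refine lintegral_congr fun past => ?_
  rw [Measure.lintegral_bind (hmp past).aemeasurable hG.aemeasurable]
  refine lintegral_congr fun f => ?_
  exact lintegral_map hG ((MDP.measurable_snoc_const t).comp
      (f := fun y => (past, ((f, y) : Record S A H 𝓗))) (by fun_prop))

lemma isProbabilityMeasure_runLaw (hB : BoundedLoss M l B) (hl : MeasurableLoss l)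
    (hπ : MeasurableExploration πexp)
    (hη : 0 ≤ η) (hγ : 0 ≤ γ) (hv : ∀ f, F.predValue f ≤ v) (t : ℕ) :
    IsProbabilityMeasure (runLaw F l πexp p0 η γ t) := by
  induction t with
  | zero => exact inferInstanceAs (IsProbabilityMeasure (Measure.dirac _))
  | succ t ih =>
    have h := lintegral_runLaw_succ (p0 := p0) (t := t) hB hl hπ hη hγ hv
      (measurable_const (a := (1 : ℝ≥0∞)))
    have hp := fun past : Fin t → Record S A H 𝓗 =>
      isProbabilityMeasure_posterior (p0 := p0) hB hl hη hγ hv past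
    simp only [lintegral_const, measure_univ, mul_one, one_mul] at h
    exact ⟨h⟩

/-- Products of record weights whose conditional mean is at most one are supermartingales. -/
lemma lintegral_runLaw_prod_le_one (hB : BoundedLoss M l B) (hl : MeasurableLoss l)
    (hπ : MeasurableExploration πexp)
    (hη : 0 ≤ η) (hγ : 0 ≤ γ) (hv : ∀ f, F.predValue f ≤ v)
    {w : Record S A H 𝓗 → ℝ≥0∞} (hw : Measurable w)
    (hw1 : ∀ f, ∫⁻ y, w (f, y) ∂(sampleLaw M πexp f) ≤ 1) (t : ℕ) :
    ∫⁻ past, ∏ s, w (past s) ∂(runLaw F l πexp p0 η γ t) ≤ 1 := by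
  induction t with
  | zero =>
    have : IsProbabilityMeasure (runLaw F l πexp p0 η γ 0) :=
      inferInstanceAs (IsProbabilityMeasure (Measure.dirac _))
    simp
  | succ t ih =>
    refine (lintegral_runLaw_succ hB hl hπ hη hγ hv
      (Finset.measurable_fun_prod _ fun s _ => hw.comp (measurable_pi_apply s))).trans_le ?_
    refine le_trans (lintegral_mono fun past => ?_) ih
    simp only [Function.comp_apply]
    have hp := isProbabilityMeasure_posterior (p0 := p0) hB hl hη hγ hv past
    calc ∫⁻ f, ∫⁻ y, ∏ s, w (Fin.snoc (α := fun _ => Record S A H 𝓗) past (f, y) s)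
          ∂(sampleLaw M πexp f) ∂(posterior F l p0 η γ past)
        ≤ ∫⁻ _f, ∏ s, w (past s) ∂(posterior F l p0 η γ past) := lintegral_mono fun f => by
          simp only [Fin.prod_univ_castSucc, Fin.snoc_castSucc, Fin.snoc_last]
          have hwf : Measurable fun y => w (f, y) := hw.comp measurable_prodMk_left
          rw [lintegral_const_mul _ hwf]
          exact (mul_le_mul_right (hw1 f) _).trans (mul_one _).le
      _ = ∏ s, w (past s) := by simp

end Class

end ModelFree

/-! ### The exponential supermartingale and its prior averages. -/

namespace ModelFree

section Class

variable {S A : Type*} [MeasurableSpace S] [MeasurableSpace A] {H : ℕ} {M : MDP S A H}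
  {𝓗 : Fin (H + 1) → Type*} [∀ i, MeasurableSpace (𝓗 i)] {F : HypothesisClass M 𝓗}
  {l : Loss S A H 𝓗} {πexp : (∀ i, 𝓗 i) → Fin H → Policy S A}
  {p0 : ∀ i, Measure (𝓗 i)} [∀ i, IsProbabilityMeasure (p0 i)] {η γ v B : ℝ}
  {fstar : ∀ i, 𝓗 i}

variable (M) in
/-- The logarithm of the factor that one record contributes to the exponential supermartingale of
the pairs `(g h, g' h)`. -/
def logWeight (l : Loss S A H 𝓗) (πexp : (∀ i, 𝓗 i) → Fin H → Policy S A) (η : ℝ)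
    (g : ∀ h : Fin H, 𝓗 h.castSucc) (g' : ∀ h : Fin H, 𝓗 h.succ) (r : Record S A H 𝓗) : ℝ :=
  ∑ h, (-η * excessLoss M l r.1 h (g h) (g' h) (r.2 h)
    + η / 10 * meanDiscrepancy M l πexp r.1 h (g h) (g' h))

variable (M) in
/-- The cumulative excess loss over the past iterations. -/
def cumExcess (l : Loss S A H 𝓗) {t : ℕ} (past : Fin t → Record S A H 𝓗) (h : Fin H)
    (g : 𝓗 h.castSucc) (g' : 𝓗 h.succ) : ℝ :=
  ∑ s, excessLoss M l (past s).1 h g g' ((past s).2 h)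

variable (M) in
/-- The prior exponential moment of the cumulative excess loss. -/
def excessMoment (l : Loss S A H 𝓗) (p0 : ∀ i, Measure (𝓗 i)) (η : ℝ) {t : ℕ}
    (past : Fin t → Record S A H 𝓗) (h : Fin H) (g' : 𝓗 h.succ) : ℝ :=
  ∫ g, Real.exp (-η * cumExcess M l past h g g') ∂(p0 h.castSucc)

variable (M) in
/-- The prior mean of the product over the steps of the exponential moments of the excess loss. -/
def meanExcessMoment (l : Loss S A H 𝓗) (p0 : ∀ i, Measure (𝓗 i)) (η : ℝ) {t : ℕ}
    (past : Fin t → Record S A H 𝓗) : ℝ :=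
  ∫ f, ∏ h : Fin H, excessMoment M l p0 η past h (f h.succ) ∂(Measure.pi p0)

lemma MeasurableLoss.logWeight (hl : MeasurableLoss l) (hπ : MeasurableExploration πexp) :
    Measurable fun q : (∀ h : Fin H, 𝓗 h.castSucc) × (∀ h : Fin H, 𝓗 h.succ) × Record S A H 𝓗 =>
      logWeight M l πexp η q.1 q.2.1 q.2.2 := by
  refine Finset.measurable_fun_sum _ fun h _ => Measurable.add ?_ ?_
  · exact ((hl.excessLoss h).comp (f := fun q : (∀ h : Fin H, 𝓗 h.castSucc) ×
      (∀ h : Fin H, 𝓗 h.succ) × Record S A H 𝓗 => (q.2.2.1, q.1 h, q.2.1 h, q.2.2.2 h))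
      (by fun_prop)).const_mul _
  · exact ((hl.meanDiscrepancy hπ h).comp (f := fun q : (∀ h : Fin H, 𝓗 h.castSucc) ×
      (∀ h : Fin H, 𝓗 h.succ) × Record S A H 𝓗 => (q.2.2.1, q.1 h, q.2.1 h))
      (by fun_prop)).const_mul _

lemma MeasurableLoss.cumExcess (hl : MeasurableLoss l) (t : ℕ) (h : Fin H) :
    Measurable fun q : (Fin t → Record S A H 𝓗) × 𝓗 h.castSucc × 𝓗 h.succ =>
      cumExcess M l q.1 h q.2.1 q.2.2 :=
  Finset.measurable_fun_sum _ fun s _ => (hl.excessLoss h).comp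
    (f := fun q : (Fin t → Record S A H 𝓗) × 𝓗 h.castSucc × 𝓗 h.succ =>
      ((q.1 s).1, q.2.1, q.2.2, (q.1 s).2 h)) (by fun_prop)

lemma MeasurableLoss.exp_cumExcess (hl : MeasurableLoss l) {t : ℕ}
    (past : Fin t → Record S A H 𝓗) (h : Fin H) (g' : 𝓗 h.succ) :
    Measurable fun g => Real.exp (-η * ModelFree.cumExcess M l past h g g') :=
  (((hl.cumExcess t h).comp (f := fun g => (past, g, g')) (by fun_prop)).const_mul (-η)).exp

lemma MeasurableLoss.excessMoment (hl : MeasurableLoss l) (t : ℕ) (h : Fin H) :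
    Measurable fun q : (Fin t → Record S A H 𝓗) × 𝓗 h.succ =>
      excessMoment M l p0 η q.1 h q.2 := by
  refine (StronglyMeasurable.integral_prod_right' (ν := p0 h.castSucc)
    (f := fun q : ((Fin t → Record S A H 𝓗) × 𝓗 h.succ) × 𝓗 h.castSucc =>
      Real.exp (-η * ModelFree.cumExcess M l q.1.1 h q.2 q.1.2))
    (Measurable.stronglyMeasurable ?_)).measurable
  exact (((hl.cumExcess t h).comp
    (f := fun q : ((Fin t → Record S A H 𝓗) × 𝓗 h.succ) × 𝓗 h.castSucc =>
      (q.1.1, q.2, q.1.2)) (by fun_prop)).const_mul (-η)).exp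

lemma MeasurableLoss.prod_excessMoment (hl : MeasurableLoss l) (t : ℕ) :
    Measurable fun q : (Fin t → Record S A H 𝓗) × (∀ i, 𝓗 i) =>
      ∏ h : Fin H, ModelFree.excessMoment M l p0 η q.1 h (q.2 h.succ) :=
  Finset.measurable_fun_prod _ fun h _ => (hl.excessMoment t h).comp
    (f := fun q : (Fin t → Record S A H 𝓗) × (∀ i, 𝓗 i) => (q.1, q.2 h.succ)) (by fun_prop)

lemma MeasurableLoss.prod_excessMoment_past (hl : MeasurableLoss l) {t : ℕ}
    (past : Fin t → Record S A H 𝓗) :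
    Measurable fun f : ∀ i, 𝓗 i =>
      ∏ h : Fin H, ModelFree.excessMoment M l p0 η past h (f h.succ) :=
  Finset.measurable_fun_prod _ fun h _ => (hl.excessMoment t h).comp
    (f := fun f : ∀ i, 𝓗 i => (past, f h.succ)) (by fun_prop)

lemma MeasurableLoss.meanExcessMoment (hl : MeasurableLoss l) (t : ℕ) :
    Measurable fun past : Fin t → Record S A H 𝓗 => meanExcessMoment M l p0 η past :=
  (StronglyMeasurable.integral_prod_right' (ν := Measure.pi p0)
    (f := fun q : (Fin t → Record S A H 𝓗) × (∀ i, 𝓗 i) =>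
      ∏ h : Fin H, ModelFree.excessMoment M l p0 η q.1 h (q.2 h.succ))
    (hl.prod_excessMoment t).stronglyMeasurable).measurable

/-- The steps are sampled in separate episodes, so the mean factors over h. In each factor the
compensator exp((η/10)·discrepancy) cancels the decay of the exponential moment of the excess. -/
lemma lintegral_exp_logWeight_le_one (hc : GeneralizedCompleteness M l fstar) (hB0 : 0 < B)
    (hB : BoundedLoss M l B) (hl : MeasurableLoss l) (hη : η = 3 / (10 * B ^ 2))
    (g : ∀ h : Fin H, 𝓗 h.castSucc) (g' : ∀ h : Fin H, 𝓗 h.succ) (f : ∀ i, 𝓗 i) :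
    ∫⁻ y, ENNReal.ofReal (Real.exp (logWeight M l πexp η g g' (f, y)))
      ∂(sampleLaw M πexp f) ≤ 1 := by
  simp only [logWeight, Real.exp_sum]
  simp only [ENNReal.ofReal_prod_of_nonneg fun _ _ => (Real.exp_pos _).le]
  have hm : ∀ h : Fin H, Measurable fun y =>
      -η * excessLoss M l f h (g h) (g' h) y := fun h =>
    ((hl.excessLoss h).comp (f := fun y => (f, g h, g' h, y)) (by fun_prop)).const_mul _
  rw [sampleLaw, lintegral_pi_prod _ (f := fun h y => ENNReal.ofReal (Real.exp
    (-η * excessLoss M l f h (g h) (g' h) y + η / 10 * meanDiscrepancy M l πexp f h (g h) (g' h))))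
    fun h => ((hm h).add_const _).exp.ennreal_ofReal]
  refine Finset.prod_le_one' fun h _ => ?_
  have hi : Integrable (fun y => Real.exp (-η * excessLoss M l f h (g h) (g' h) y))
      (M.stepLaw (πexp f h) h) :=
    integrable_of_abs_le (hm h).exp (Real.exp (|η| * (3 * B * B))) fun y => by
      rw [abs_of_pos (Real.exp_pos _)]
      refine Real.exp_le_exp.2 ((le_abs_self _).trans ?_)
      rw [abs_mul, abs_neg]
      exact mul_le_mul_of_nonneg_left (abs_excessLoss_le_sq hc hB hl _ _ _ _ _) (abs_nonneg _)
  simp only [Real.exp_add]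
  rw [← ofReal_integral_eq_lintegral_ofReal (hi.mul_const _)
    (Filter.Eventually.of_forall fun y => by positivity), integral_mul_const]
  refine ENNReal.ofReal_le_one.2 ?_
  have := integral_exp_excessLoss_le hc hB0 hB hl hη (πexp f h) f h (g h) (g' h)
  calc _ ≤ Real.exp (-(η / 10 * meanDiscrepancy M l πexp f h (g h) (g' h)))
        * Real.exp (η / 10 * meanDiscrepancy M l πexp f h (g h) (g' h)) :=
        mul_le_mul_of_nonneg_right this (Real.exp_pos _).le
    _ = 1 := by rw [← Real.exp_add]; simp

/-- The pair is fixed before the run, so adaptivity is harmless: whatever hypothesis is drawn, the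
next factor has conditional mean at most one. -/
lemma lintegral_runLaw_exp_logWeight_le_one (hc : GeneralizedCompleteness M l fstar) (hB0 : 0 < B)
    (hB : BoundedLoss M l B) (hl : MeasurableLoss l) (hπ : MeasurableExploration πexp)
    (hη : η = 3 / (10 * B ^ 2)) (hγ : 0 ≤ γ) (hv : ∀ f, F.predValue f ≤ v) (t : ℕ)
    (g : ∀ h : Fin H, 𝓗 h.castSucc) (g' : ∀ h : Fin H, 𝓗 h.succ) :
    ∫⁻ past, ENNReal.ofReal (Real.exp (∑ s, logWeight M l πexp η g g' (past s)))
      ∂(runLaw F l πexp p0 η γ t) ≤ 1 := by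
  have hη0 : 0 ≤ η := by rw [hη]; positivity
  simp only [Real.exp_sum]
  simp only [ENNReal.ofReal_prod_of_nonneg fun _ _ => (Real.exp_pos _).le]
  refine lintegral_runLaw_prod_le_one hB hl hπ hη0 hγ hv
    (w := fun r => ENNReal.ofReal (Real.exp (logWeight M l πexp η g g' r))) ?_
    (fun f => lintegral_exp_logWeight_le_one hc hB0 hB hl hη g g' f) t
  exact ((hl.logWeight hπ).comp (f := fun r => (g, g', r)) (by fun_prop)).exp.ennreal_ofReal

lemma MeasurableLoss.sum_logWeight (hl : MeasurableLoss l) (hπ : MeasurableExploration πexp)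
    (t : ℕ) :
    Measurable fun q : (Fin t → Record S A H 𝓗) ×
      ((∀ h : Fin H, 𝓗 h.castSucc) × (∀ h : Fin H, 𝓗 h.succ)) =>
      ∑ s, ModelFree.logWeight M l πexp η q.2.1 q.2.2 (q.1 s) :=
  Finset.measurable_fun_sum _ fun s _ => (hl.logWeight hπ).comp
    (f := fun q : (Fin t → Record S A H 𝓗) ×
      ((∀ h : Fin H, 𝓗 h.castSucc) × (∀ h : Fin H, 𝓗 h.succ)) => (q.2.1, q.2.2, q.1 s))
    (by fun_prop)

lemma MeasurableLoss.exp_sum_logWeight (hl : MeasurableLoss l) (hπ : MeasurableExploration πexp)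
    {t : ℕ} (past : Fin t → Record S A H 𝓗) :
    Measurable fun q : (∀ h : Fin H, 𝓗 h.castSucc) × (∀ h : Fin H, 𝓗 h.succ) =>
      ENNReal.ofReal (Real.exp (∑ s, ModelFree.logWeight M l πexp η q.1 q.2 (past s))) :=
  Measurable.ennreal_ofReal (Measurable.exp
    (Finset.measurable_fun_sum _ fun s _ => (hl.logWeight hπ).comp
      (f := fun q : (∀ h : Fin H, 𝓗 h.castSucc) × (∀ h : Fin H, 𝓗 h.succ) => (q.1, q.2, past s))
      (by fun_prop)))

/-- The exponential supermartingale averaged over random pairs that do not depend on the run. -/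
lemma lintegral_runLaw_lintegral_le_one (hc : GeneralizedCompleteness M l fstar) (hB0 : 0 < B)
    (hB : BoundedLoss M l B) (hl : MeasurableLoss l) (hπ : MeasurableExploration πexp)
    (hη : η = 3 / (10 * B ^ 2)) (hγ : 0 ≤ γ) (hv : ∀ f, F.predValue f ≤ v) (t : ℕ)
    (μ : Measure ((∀ h : Fin H, 𝓗 h.castSucc) × (∀ h : Fin H, 𝓗 h.succ)))
    [IsProbabilityMeasure μ] :
    ∫⁻ past, ∫⁻ q, ENNReal.ofReal (Real.exp (∑ s, logWeight M l πexp η q.1 q.2 (past s))) ∂μ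
      ∂(runLaw F l πexp p0 η γ t) ≤ 1 := by
  have hη0 : 0 ≤ η := by rw [hη]; positivity
  have := isProbabilityMeasure_runLaw (p0 := p0) hB hl hπ hη0 hγ hv t
  have hm : Measurable (Function.uncurry fun (past : Fin t → Record S A H 𝓗)
      (q : (∀ h : Fin H, 𝓗 h.castSucc) × (∀ h : Fin H, 𝓗 h.succ)) =>
      ENNReal.ofReal (Real.exp (∑ s, logWeight M l πexp η q.1 q.2 (past s)))) :=
    Measurable.ennreal_ofReal (Measurable.exp (hl.sum_logWeight hπ t))
  rw [lintegral_lintegral_swap hm.aemeasurable]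
  calc _ ≤ ∫⁻ _q, 1 ∂μ := lintegral_mono fun q =>
        lintegral_runLaw_exp_logWeight_le_one hc hB0 hB hl hπ hη hγ hv t q.1 q.2
    _ = 1 := by simp

/-- Here both components of the pair come from one prior draw. This is the average that appears once
the posterior is rewritten against the prior. -/
lemma lintegral_runLaw_prior_le_one (hc : GeneralizedCompleteness M l fstar) (hB0 : 0 < B)
    (hB : BoundedLoss M l B) (hl : MeasurableLoss l) (hπ : MeasurableExploration πexp)
    (hη : η = 3 / (10 * B ^ 2)) (hγ : 0 ≤ γ) (hv : ∀ f, F.predValue f ≤ v) (t : ℕ) :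
    ∫⁻ past, ∫⁻ f, ENNReal.ofReal (Real.exp (∑ s, logWeight M l πexp η
      (fun h => f h.castSucc) (fun h => f h.succ) (past s))) ∂(Measure.pi p0)
      ∂(runLaw F l πexp p0 η γ t) ≤ 1 := by
  have hm : Measurable fun f : ∀ i, 𝓗 i =>
      ((fun h : Fin H => f h.castSucc), (fun h : Fin H => f h.succ)) := by fun_prop
  have : IsProbabilityMeasure ((Measure.pi p0).map fun f : ∀ i, 𝓗 i =>
      ((fun h : Fin H => f h.castSucc), (fun h : Fin H => f h.succ))) :=
    Measure.isProbabilityMeasure_map hm.aemeasurable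
  have h := lintegral_runLaw_lintegral_le_one (p0 := p0) hc hB0 hB hl hπ hη hγ hv t
    ((Measure.pi p0).map fun f : ∀ i, 𝓗 i =>
      ((fun h : Fin H => f h.castSucc), (fun h : Fin H => f h.succ)))
  refine le_trans (le_of_eq (lintegral_congr fun past => ?_)) h
  exact (lintegral_map (hl.exp_sum_logWeight hπ past) hm).symm

lemma abs_cumExcess_le (hc : GeneralizedCompleteness M l fstar) (hB : BoundedLoss M l B)
    (hl : MeasurableLoss l) {t : ℕ} {past : Fin t → Record S A H 𝓗} {h : Fin H}
    {g : 𝓗 h.castSucc} {g' : 𝓗 h.succ} {ε : ℝ} (hε : ∀ s, |condLoss M l (past s).1 h g g'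
      (((past s).2 h).1, ((past s).2 h).2.1)| ≤ ε) :
    |cumExcess M l past h g g'| ≤ t * (3 * B * ε) := by
  refine (Finset.abs_sum_le_sum_abs _ _).trans ?_
  have : ∑ s, |excessLoss M l (past s).1 h g g' ((past s).2 h)| ≤ ∑ _s : Fin t, 3 * B * ε :=
    Finset.sum_le_sum fun s _ => abs_excessLoss_le hc hB hl (hε s)
  simpa using this

lemma abs_cumExcess_le_sq (hc : GeneralizedCompleteness M l fstar) (hB : BoundedLoss M l B)
    (hl : MeasurableLoss l) {t : ℕ} (past : Fin t → Record S A H 𝓗) (h : Fin H)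
    (g : 𝓗 h.castSucc) (g' : 𝓗 h.succ) :
    |cumExcess M l past h g g'| ≤ t * (3 * B * B) :=
  abs_cumExcess_le hc hB hl fun _ => hB.condLoss hl _ _ _ _ _

lemma exp_cumExcess_mem_Icc (hc : GeneralizedCompleteness M l fstar) (hB : BoundedLoss M l B)
    (hl : MeasurableLoss l) (hη : 0 ≤ η) {t : ℕ} (past : Fin t → Record S A H 𝓗) (h : Fin H)
    (g : 𝓗 h.castSucc) (g' : 𝓗 h.succ) :
    Real.exp (-η * cumExcess M l past h g g') ∈
      Set.Icc (Real.exp (-(η * (t * (3 * B * B))))) (Real.exp (η * (t * (3 * B * B)))) := by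
  have := abs_le.1 (abs_cumExcess_le_sq hc hB hl past h g g')
  constructor <;> refine Real.exp_le_exp.2 ?_ <;> nlinarith

lemma excessMoment_mem_Icc (hc : GeneralizedCompleteness M l fstar) (hB : BoundedLoss M l B)
    (hl : MeasurableLoss l) (hη : 0 ≤ η) {t : ℕ} (past : Fin t → Record S A H 𝓗) (h : Fin H)
    (g' : 𝓗 h.succ) :
    excessMoment M l p0 η past h g' ∈
      Set.Icc (Real.exp (-(η * (t * (3 * B * B))))) (Real.exp (η * (t * (3 * B * B)))) :=
  integral_mem_Icc_of_forall (hl.exp_cumExcess past h g')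
    fun g => exp_cumExcess_mem_Icc hc hB hl hη past h g g'

lemma excessMoment_pos (hc : GeneralizedCompleteness M l fstar) (hB : BoundedLoss M l B)
    (hl : MeasurableLoss l) (hη : 0 ≤ η) {t : ℕ} (past : Fin t → Record S A H 𝓗) (h : Fin H)
    (g' : 𝓗 h.succ) : 0 < excessMoment M l p0 η past h g' :=
  (Real.exp_pos _).trans_le (excessMoment_mem_Icc hc hB hl hη past h g').1

lemma prod_excessMoment_mem_Icc (hc : GeneralizedCompleteness M l fstar) (hB : BoundedLoss M l B)
    (hl : MeasurableLoss l) (hη : 0 ≤ η) {t : ℕ} (past : Fin t → Record S A H 𝓗)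
    (f : ∀ i, 𝓗 i) :
    ∏ h : Fin H, excessMoment M l p0 η past h (f h.succ) ∈
      Set.Icc (Real.exp (-(η * (t * (3 * B * B)))) ^ H) (Real.exp (η * (t * (3 * B * B))) ^ H) := by
  have h := fun h => excessMoment_mem_Icc (p0 := p0) hc hB hl hη past h (f h.succ)
  constructor
  · simpa using Finset.prod_le_prod (s := Finset.univ) (fun _ _ => (Real.exp_pos _).le)
      fun i _ => (h i).1
  · simpa using Finset.prod_le_prod (s := Finset.univ)
      (fun i _ => (excessMoment_pos hc hB hl hη past i (f i.succ)).le) fun i _ => (h i).2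

lemma integrable_prod_excessMoment (hc : GeneralizedCompleteness M l fstar)
    (hB : BoundedLoss M l B) (hl : MeasurableLoss l) (hη : 0 ≤ η) {t : ℕ}
    (past : Fin t → Record S A H 𝓗) :
    Integrable (fun f => ∏ h : Fin H, excessMoment M l p0 η past h (f h.succ)) (Measure.pi p0) :=
  integrable_of_abs_le (hl.prod_excessMoment_past past)
    (Real.exp (η * (t * (3 * B * B))) ^ H) fun f => by
      have := prod_excessMoment_mem_Icc (p0 := p0) hc hB hl hη past f
      rw [abs_of_nonneg ((pow_pos (Real.exp_pos _) _).le.trans this.1)]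
      exact this.2

lemma meanExcessMoment_pos (hc : GeneralizedCompleteness M l fstar) (hB : BoundedLoss M l B)
    (hl : MeasurableLoss l) (hη : 0 ≤ η) {t : ℕ} (past : Fin t → Record S A H 𝓗) :
    0 < meanExcessMoment M l p0 η past :=
  (pow_pos (Real.exp_pos _) _).trans_le (integral_mem_Icc_of_forall
    (hl.prod_excessMoment_past past)
    fun f => prod_excessMoment_mem_Icc hc hB hl hη past f).1

/-- The log-likelihood may be computed from excess losses in place of squared losses. -/
lemma logLik_eq (hc : GeneralizedCompleteness M l fstar) (hB : BoundedLoss M l B)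
    (hl : MeasurableLoss l) (hη : 0 ≤ η) {t : ℕ} (past : Fin t → Record S A H 𝓗) (h : Fin H)
    (f : ∀ i, 𝓗 i) :
    logLik M l p0 η past h f = -η * cumExcess M l past h (f h.castSucc) (f h.succ)
      - Real.log (excessMoment M l p0 η past h (f h.succ)) := by
  -- The squared loss of `g₀`, the completion of f_{h+1}, is common to all g. It factors out of the
  -- normalizer and cancels.
  obtain ⟨g₀, hg₀⟩ := hc.exists_sq_eq h (f h.succ)
  have hsq : ∀ g, sqLoss M l past h g (f h.succ)
      = cumExcess M l past h g (f h.succ) + sqLoss M l past h g₀ (f h.succ) := fun g => by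
    simp only [sqLoss, cumExcess, hg₀ _ g, Finset.sum_add_distrib]
  have hI : ∫ g, Real.exp (-η * sqLoss M l past h g (f h.succ)) ∂(p0 h.castSucc)
      = excessMoment M l p0 η past h (f h.succ)
        * Real.exp (-η * sqLoss M l past h g₀ (f h.succ)) := by
    rw [excessMoment, ← integral_mul_const]
    refine integral_congr_ae (Filter.Eventually.of_forall fun g => ?_)
    simp only [hsq g, mul_add, Real.exp_add]
  rw [logLik, hI, Real.log_mul (excessMoment_pos hc hB hl hη past h _).ne' (Real.exp_pos _).ne',
    Real.log_exp, hsq]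
  ring

/-- A product over h of integrals over g_h is one integral over an independent family g, so this is
a supermartingale average over pairs (g_h, f_{h+1}) with g and f independent. For this reason
`logWeight` takes the two components separately. -/
lemma lintegral_runLaw_meanExcessMoment_le_one (hc : GeneralizedCompleteness M l fstar)
    (hB0 : 0 < B) (hB : BoundedLoss M l B) (hl : MeasurableLoss l)
    (hπ : MeasurableExploration πexp) (hη : η = 3 / (10 * B ^ 2)) (hγ : 0 ≤ γ)
    (hv : ∀ f, F.predValue f ≤ v) (t : ℕ) :
    ∫⁻ past, ENNReal.ofReal (meanExcessMoment M l p0 η past)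
      ∂(runLaw F l πexp p0 η γ t) ≤ 1 := by
  have hη0 : 0 ≤ η := by rw [hη]; positivity
  have hm : Measurable fun f : ∀ i, 𝓗 i => (fun h : Fin H => f h.succ) := by fun_prop
  let ν : Measure (∀ h : Fin H, 𝓗 h.castSucc) := Measure.pi fun h => p0 h.castSucc
  let ρ : Measure (∀ h : Fin H, 𝓗 h.succ) := (Measure.pi p0).map fun f h => f h.succ
  have hρ : IsProbabilityMeasure ρ := Measure.isProbabilityMeasure_map hm.aemeasurable
  refine le_trans (lintegral_mono fun past => ?_)
    (lintegral_runLaw_lintegral_le_one (F := F) (p0 := p0) (γ := γ) hc hB0 hB hl hπ hη hγ hv t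
      (ν.prod ρ))
  have hmw := hl.exp_sum_logWeight (M := M) (η := η) hπ past
  rw [lintegral_prod_symm' _ hmw, lintegral_map hmw.lintegral_prod_left' hm, meanExcessMoment,
    ofReal_integral_eq_lintegral_ofReal (integrable_prod_excessMoment hc hB hl hη0 past)
      (Filter.Eventually.of_forall fun f =>
        (pow_pos (Real.exp_pos _) _).le.trans (prod_excessMoment_mem_Icc hc hB hl hη0 past f).1)]
  refine lintegral_mono fun f => ?_
  calc ENNReal.ofReal (∏ h : Fin H, excessMoment M l p0 η past h (f h.succ))
      = ∏ h : Fin H, ∫⁻ g, ENNReal.ofReal (Real.exp (-η * cumExcess M l past h g (f h.succ)))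
          ∂(p0 h.castSucc) := by
        rw [ENNReal.ofReal_prod_of_nonneg fun h _ => (excessMoment_pos hc hB hl hη0 past h _).le]
        refine Finset.prod_congr rfl fun h _ => ?_
        refine ofReal_integral_eq_lintegral_ofReal (integrable_of_abs_le
          (hl.exp_cumExcess past h _) (Real.exp (η * (t * (3 * B * B)))) fun g => ?_)
          (Filter.Eventually.of_forall fun g => (Real.exp_pos _).le)
        rw [abs_of_pos (Real.exp_pos _)]
        exact (exp_cumExcess_mem_Icc hc hB hl hη0 past h g _).2
    _ = ∫⁻ g, ∏ h, ENNReal.ofReal (Real.exp (-η * cumExcess M l past h (g h) (f h.succ))) ∂ν :=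
        (lintegral_pi_prod (fun h : Fin H => p0 h.castSucc)
          fun h => (hl.exp_cumExcess past h (f h.succ)).ennreal_ofReal).symm
    _ ≤ ∫⁻ g, ENNReal.ofReal (Real.exp (∑ s, logWeight M l πexp η g
          (fun h => f h.succ) (past s))) ∂ν := lintegral_mono fun g => by
        rw [← ENNReal.ofReal_prod_of_nonneg fun _ _ => (Real.exp_pos _).le, ← Real.exp_sum]
        refine ENNReal.ofReal_le_ofReal (Real.exp_le_exp.2 ?_)
        simp only [cumExcess, logWeight, Finset.mul_sum]
        rw [Finset.sum_comm]
        refine Finset.sum_le_sum fun s _ => Finset.sum_le_sum fun h _ => ?_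
        -- The compensator is not needed here and is dropped by its sign.
        have := meanDiscrepancy_nonneg (M := M) l πexp (past s).1 h (g h) (f h.succ)
        have : 0 ≤ η / 10 * meanDiscrepancy M l πexp (past s).1 h (g h) (f h.succ) := by positivity
        linarith

end Class

end ModelFree

/-! ### The normalizing constant and the expected round loss. -/

namespace ModelFree

section Class

variable {S A : Type*} [MeasurableSpace S] [MeasurableSpace A] {H : ℕ} {M : MDP S A H}
  {𝓗 : Fin (H + 1) → Type*} [∀ i, MeasurableSpace (𝓗 i)] {F : HypothesisClass M 𝓗}
  {l : Loss S A H 𝓗} {πexp : (∀ i, 𝓗 i) → Fin H → Policy S A}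
  {p0 : ∀ i, Measure (𝓗 i)} [∀ i, IsProbabilityMeasure (p0 i)] {η γ v B : ℝ}
  {fstar : ∀ i, 𝓗 i} {ε κ : ℝ} {k : Fin H → ℝ}

/-- On the nearly complete set the cumulative excess is at most 3Btε, so the exponential is bounded
below there. Markov's inequality multiplies this by the prior mass and works with the outer measure,
as the set need not be measurable. -/
lemma le_excessMoment (hc : GeneralizedCompleteness M l fstar)
    (hB : BoundedLoss M l B) (hl : MeasurableLoss l) (hη : 0 ≤ η)
    {h : Fin H} {k : ℝ} {g' : 𝓗 h.succ}
    (hk : Real.exp (-k) ≤ (p0 h.castSucc).real (nearComplete M l ε h g')) {t : ℕ}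
    (past : Fin t → Record S A H 𝓗) :
    Real.exp (-k - η * (t * (3 * B * ε))) ≤ excessMoment M l p0 η past h g' := by
  set a := Real.exp (-(η * (t * (3 * B * ε))))
  set E : 𝓗 h.castSucc → ℝ := fun g => Real.exp (-η * cumExcess M l past h g g')
  have hEm : Measurable E := hl.exp_cumExcess past h g'
  have hEi : Integrable E (p0 h.castSucc) := integrable_of_abs_le hEm
    (Real.exp (η * (t * (3 * B * B)))) fun g => by
      rw [abs_of_pos (Real.exp_pos _)]
      exact (exp_cumExcess_mem_Icc hc hB hl hη past h g g').2
  have hsub : nearComplete M l ε h g' ⊆ {g | a ≤ E g} := fun g hg => by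
    have := abs_le.1 (abs_cumExcess_le (past := past) hc hB hl fun s => hg (past s).1 _)
    refine Real.exp_le_exp.2 ?_
    nlinarith
  have hmarkov := mul_meas_ge_le_integral_of_nonneg
    (Filter.Eventually.of_forall fun g => (Real.exp_pos _).le : 0 ≤ᵐ[p0 h.castSucc] E) hEi a
  calc Real.exp (-k - η * (t * (3 * B * ε))) = a * Real.exp (-k) := by
        rw [← Real.exp_add]; ring_nf
    _ ≤ a * (p0 h.castSucc).real {g | a ≤ E g} :=
        mul_le_mul_of_nonneg_left (hk.trans (measureReal_mono hsub)) (Real.exp_pos _).le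
    _ ≤ _ := hmarkov

/-- A lower bound for the normalizing constant of the posterior. -/
lemma le_normalizer_mul (hc : GeneralizedCompleteness M l fstar)
    (hB : BoundedLoss M l B) (hl : MeasurableLoss l) (hη : 0 ≤ η) (hγ : 0 ≤ γ)
    (hv : ∀ f, F.predValue f ≤ v)
    (hκ : Real.exp (-κ) ≤ (Measure.pi p0).real (nearOptimal F l fstar ε)) {t : ℕ}
    (past : Fin t → Record S A H 𝓗) :
    Real.exp (γ * F.predValue fstar - γ * ε - H * (η * (t * (3 * B * ε))) - 2 * κ) ≤
      (∫ f, Real.exp (posteriorExponent F l p0 η γ past f) ∂(Measure.pi p0))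
        * meanExcessMoment M l p0 η past := by
  set Y : (∀ i, 𝓗 i) → ℝ := fun f => ∏ h : Fin H, excessMoment M l p0 η past h (f h.succ) with hY
  set I := meanExcessMoment M l p0 η past with hI
  set a := Real.exp (γ * F.predValue fstar - γ * ε - H * (η * (t * (3 * B * ε)))) with ha
  -- `nearOptimal` quantifies over all f', x, a and need not be measurable. `G` keeps only the
  -- finitely many conditions at observed data: it is measurable, contains `nearOptimal`, and
  -- suffices for the likelihood bound.
  set G : Set (∀ i, 𝓗 i) := {f | F.predValue fstar - F.predValue f < ε ∧
    ∀ (s : Fin t) (h : Fin H), |condLoss M l (past s).1 h (f h.castSucc) (f h.succ)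
      (((past s).2 h).1, ((past s).2 h).2.1)| ≤ ε} with hG
  have hIpos : 0 < I := meanExcessMoment_pos hc hB hl hη past
  have hYpos : ∀ f, 0 < Y f := fun f =>
    Finset.prod_pos fun h _ => excessMoment_pos hc hB hl hη past h _
  have hYi : Integrable Y (Measure.pi p0) := integrable_prod_excessMoment hc hB hl hη past
  have hGm : MeasurableSet G := by
    have hGi : G = {f | F.predValue fstar - F.predValue f < ε} ∩ ⋂ (s : Fin t), ⋂ (h : Fin H),
        {f | |condLoss M l (past s).1 h (f h.castSucc) (f h.succ)
          (((past s).2 h).1, ((past s).2 h).2.1)| ≤ ε} := by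
      ext f; simp [hG]
    rw [hGi]
    refine (measurableSet_lt (F.measurable_predValue.const_sub _) measurable_const).inter ?_
    refine MeasurableSet.iInter fun s => MeasurableSet.iInter fun h => ?_
    refine measurableSet_le ?_ measurable_const
    exact Measurable.abs ((hl.condLoss_obs h).comp
      (f := fun f : ∀ i, 𝓗 i => ((past s).1, f h.castSucc, f h.succ, (past s).2 h))
      (by fun_prop))
  have hsub : nearOptimal F l fstar ε ⊆ G := fun f hf => ⟨hf.1, fun s h => hf.2 _ _ _⟩
  set q := (Measure.pi p0).real G with hq
  have hq0 : Real.exp (-κ) ≤ q := hκ.trans (measureReal_mono hsub)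
  have hqpos : 0 < q := (Real.exp_pos _).trans_le hq0
  -- 1/y lies above its tangent 2λ - λ²y at y = 1/λ. Integrating over `G` gives 2λq - λ²I, which is
  -- maximal at λ = q/I with value q²/I: the Cauchy-Schwarz bound.
  set lam := q / I with hlam
  have hlampos : 0 < lam := div_pos hqpos hIpos
  have hpt : ∀ f ∈ G, a * (2 * lam - lam ^ 2 * Y f)
      ≤ Real.exp (posteriorExponent F l p0 η γ past f) := fun f hf => by
    have h1 : a * (Y f)⁻¹ ≤ Real.exp (posteriorExponent F l p0 η γ past f) := by
      rw [hY, ← Real.exp_log (inv_pos.2 (hYpos f)), ha, ← Real.exp_add]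
      refine Real.exp_le_exp.2 ?_
      rw [Real.log_inv, hY, Real.log_prod fun h _ => (excessMoment_pos hc hB hl hη past h _).ne']
      simp only [posteriorExponent, logLik_eq hc hB hl hη, Finset.sum_sub_distrib]
      have h2 : -(H * (η * (t * (3 * B * ε)))) ≤
          ∑ h : Fin H, -η * cumExcess M l past h (f h.castSucc) (f h.succ) := by
        have : ∑ _h : Fin H, -(η * (t * (3 * B * ε))) ≤
            ∑ h : Fin H, -η * cumExcess M l past h (f h.castSucc) (f h.succ) :=
          Finset.sum_le_sum fun h _ => by
            have := abs_le.1 (abs_cumExcess_le (past := past) hc hB hl fun s => hf.2 s h)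
            nlinarith
        simpa using this
      have h3 := mul_le_mul_of_nonneg_left hf.1.le hγ
      linarith
    refine le_trans (mul_le_mul_of_nonneg_left ?_ (Real.exp_pos _).le) h1
    have h4 : 0 ≤ (1 - lam * Y f) ^ 2 / Y f := div_nonneg (sq_nonneg _) (hYpos f).le
    have h5 : (1 - lam * Y f) ^ 2 / Y f = (Y f)⁻¹ - (2 * lam - lam ^ 2 * Y f) := by
      have := (hYpos f).ne'
      field_simp
      ring
    linarith
  have hΨi := integrable_exp_posteriorExponent (F := F) (p0 := p0) hB hl hη hγ hv past
  have hYG : ∫ f in G, Y f ∂(Measure.pi p0) ≤ I :=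
    setIntegral_le_integral hYi (Filter.Eventually.of_forall fun f => (hYpos f).le)
  have hZ : a * (2 * lam * q - lam ^ 2 * I) ≤
      ∫ f, Real.exp (posteriorExponent F l p0 η γ past f) ∂(Measure.pi p0) := by
    calc a * (2 * lam * q - lam ^ 2 * I)
        ≤ a * (2 * lam * q - lam ^ 2 * ∫ f in G, Y f ∂(Measure.pi p0)) := by
          have := mul_le_mul_of_nonneg_left hYG (sq_nonneg lam)
          exact mul_le_mul_of_nonneg_left (by linarith) (Real.exp_pos _).le
      _ = ∫ f in G, a * (2 * lam - lam ^ 2 * Y f) ∂(Measure.pi p0) := by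
          rw [integral_const_mul, integral_sub (integrable_const _)
            (hYi.integrableOn.const_mul _), integral_const_mul (lam ^ 2), setIntegral_const, smul_eq_mul]
          ring
      _ ≤ ∫ f in G, Real.exp (posteriorExponent F l p0 η γ past f) ∂(Measure.pi p0) :=
          setIntegral_mono_on (((integrable_const _).sub (hYi.const_mul _)).const_mul _).integrableOn
            hΨi.integrableOn hGm hpt
      _ ≤ _ := setIntegral_le_integral hΨi (Filter.Eventually.of_forall fun f => (Real.exp_pos _).le)
  have hlam2 : a * (2 * lam * q - lam ^ 2 * I) * I = a * q ^ 2 := by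
    rw [hlam]; field_simp; ring
  calc Real.exp (γ * F.predValue fstar - γ * ε - H * (η * (t * (3 * B * ε))) - 2 * κ)
      = a * Real.exp (-κ) ^ 2 := by
        rw [← Real.exp_nat_mul, ← Real.exp_add]; push_cast; ring_nf
    _ ≤ a * q ^ 2 := mul_le_mul_of_nonneg_left
        (pow_le_pow_left₀ (Real.exp_pos _).le hq0 2) (Real.exp_pos _).le
    _ = a * (2 * lam * q - lam ^ 2 * I) * I := hlam2.symm
    _ ≤ _ := mul_le_mul_of_nonneg_right hZ hIpos.le

variable (F l πexp η γ fstar) in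
/-- Scaled optimism gap of `f` plus its mean discrepancies relative to the past hypotheses. -/
def roundLoss {t : ℕ} (past : Fin t → Record S A H 𝓗) (f : ∀ i, 𝓗 i) : ℝ :=
  γ * (F.predValue fstar - F.predValue f)
    + η / 10 * ∑ s, ∑ h, meanDiscrepancy M l πexp (past s).1 h (f h.castSucc) (f h.succ)

/-- The round loss is controlled by `κ` up to exponential terms whose means are at most one. -/
lemma roundLoss_le (hc : GeneralizedCompleteness M l fstar)
    (hB : BoundedLoss M l B) (hl : MeasurableLoss l) (hη : 0 ≤ η) (hγ : 0 ≤ γ)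
    (hv : ∀ f, F.predValue f ≤ v)
    (hk : ∀ (h : Fin H) (g' : 𝓗 h.succ),
      Real.exp (-k h) ≤ (p0 h.castSucc).real (nearComplete M l ε h g'))
    (hkκ : ∑ h, k h ≤ κ)
    (hκ : Real.exp (-κ) ≤ (Measure.pi p0).real (nearOptimal F l fstar ε)) {t : ℕ}
    (past : Fin t → Record S A H 𝓗) (f : ∀ i, 𝓗 i) :
    roundLoss F l πexp η γ fstar past f ≤
      3 * κ + γ * ε + 2 * (H * (η * (t * (3 * B * ε)))) - 2
      + Real.exp (∑ s, logWeight M l πexp η (fun h => f h.castSucc) (fun h => f h.succ) (past s)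
          - posteriorExponent F l p0 η γ past f)
        * (∫ f, Real.exp (posteriorExponent F l p0 η γ past f) ∂(Measure.pi p0))
      + meanExcessMoment M l p0 η past := by
  set I := meanExcessMoment M l p0 η past with hI
  set Z := ∫ f, Real.exp (posteriorExponent F l p0 η γ past f) ∂(Measure.pi p0) with hZ
  set Φ := ∑ s, logWeight M l πexp η (fun h => f h.castSucc) (fun h => f h.succ) (past s) with hΦ
  set Ψ := posteriorExponent F l p0 η γ past f with hΨ
  have hIpos : 0 < I := meanExcessMoment_pos hc hB hl hη past
  have hZI := le_normalizer_mul (F := F) (p0 := p0) hc hB hl hη hγ hv hκ past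
  rw [← hI, ← hZ] at hZI
  have hZpos : 0 < Z := pos_of_mul_pos_left ((Real.exp_pos _).trans_le hZI) hIpos.le
  have h1 := Real.log_le_log (Real.exp_pos _) hZI
  rw [Real.log_exp, Real.log_mul hZpos.ne' hIpos.ne'] at h1
  -- In place of a variational formula for the relative entropy, log u ≤ u - 1 is applied to I and
  -- to e^{Φ-Ψ}Z, both of mean at most one. The logarithms of Z cancel in the final sum.
  have h2 := Real.log_le_sub_one_of_pos hIpos
  have h3 := Real.log_le_sub_one_of_pos (mul_pos (Real.exp_pos (Φ - Ψ)) hZpos)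
  rw [Real.log_mul (Real.exp_pos _).ne' hZpos.ne', Real.log_exp] at h3
  have h4 : -(∑ h, Real.log (excessMoment M l p0 η past h (f h.succ)))
      ≤ κ + H * (η * (t * (3 * B * ε))) := by
    have : ∑ h, -Real.log (excessMoment M l p0 η past h (f h.succ))
        ≤ ∑ h : Fin H, (k h + η * (t * (3 * B * ε))) := Finset.sum_le_sum fun h _ => by
      have := Real.log_le_log (Real.exp_pos _)
        (le_excessMoment (p0 := p0) hc hB hl hη (hk h (f h.succ)) past)
      rw [Real.log_exp] at this
      linarith
    rw [Finset.sum_add_distrib, Finset.sum_neg_distrib] at this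
    simp only [Finset.sum_const, Finset.card_univ, Fintype.card_fin, nsmul_eq_mul] at this
    linarith
  have h5 : Φ - Ψ = -γ * F.predValue f
      + η / 10 * ∑ s, ∑ h, meanDiscrepancy M l πexp (past s).1 h (f h.castSucc) (f h.succ)
      + ∑ h, Real.log (excessMoment M l p0 η past h (f h.succ)) := by
    simp only [hΦ, hΨ, logWeight, posteriorExponent, logLik_eq hc hB hl hη, cumExcess,
      Finset.mul_sum, Finset.sum_add_distrib, Finset.sum_sub_distrib]
    rw [Finset.sum_comm (s := (Finset.univ : Finset (Fin H))) (t := (Finset.univ : Finset (Fin t)))]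
    ring
  unfold roundLoss
  linarith

lemma MeasurableLoss.roundLoss (hl : MeasurableLoss l) (hπ : MeasurableExploration πexp) (t : ℕ) :
    Measurable fun q : (Fin t → Record S A H 𝓗) × (∀ i, 𝓗 i) =>
      roundLoss F l πexp η γ fstar q.1 q.2 := by
  refine (((F.measurable_predValue.comp measurable_snd).const_sub _).const_mul γ).add
    (Measurable.const_mul (Finset.measurable_fun_sum _ fun s _ =>
      Finset.measurable_fun_sum _ fun h _ => ?_) _)
  exact (hl.meanDiscrepancy hπ h).comp (f := fun q : (Fin t → Record S A H 𝓗) × (∀ i, 𝓗 i) =>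
    ((q.1 s).1, q.2 h.castSucc, q.2 h.succ)) (by fun_prop)

/-- Expected round loss, shifted by a constant to make it non-negative. -/
lemma lintegral_roundLoss_le (hc : GeneralizedCompleteness M l fstar) (hB0 : 0 < B)
    (hB : BoundedLoss M l B) (hl : MeasurableLoss l) (hπ : MeasurableExploration πexp)
    (hη : η = 3 / (10 * B ^ 2)) (hγ : 0 ≤ γ) (hv : ∀ f, F.predValue f ≤ v)
    (hk : ∀ (h : Fin H) (g' : 𝓗 h.succ),
      Real.exp (-k h) ≤ (p0 h.castSucc).real (nearComplete M l ε h g'))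
    (hkκ : ∑ h, k h ≤ κ)
    (hκ : Real.exp (-κ) ≤ (Measure.pi p0).real (nearOptimal F l fstar ε)) {t : ℕ} {K b : ℝ}
    (hK : 3 * κ + γ * ε + 2 * (H * (η * (t * (3 * B * ε)))) ≤ K) (hKb : 2 ≤ K + b) :
    ∫⁻ past, ∫⁻ f, ENNReal.ofReal (roundLoss F l πexp η γ fstar past f + b)
      ∂(posterior F l p0 η γ past) ∂(runLaw F l πexp p0 η γ t) ≤ ENNReal.ofReal (K + b) := by
  have hη0 : 0 ≤ η := by rw [hη]; positivity
  have hrun := isProbabilityMeasure_runLaw (F := F) (p0 := p0) hB hl hπ hη0 hγ hv t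
  have inner : ∀ past : Fin t → Record S A H 𝓗,
      ∫⁻ f, ENNReal.ofReal (roundLoss F l πexp η γ fstar past f + b)
        ∂(posterior F l p0 η γ past) ≤
      ENNReal.ofReal (K + b - 2) + ENNReal.ofReal (meanExcessMoment M l p0 η past)
        + ∫⁻ f, ENNReal.ofReal (Real.exp (∑ s, logWeight M l πexp η
          (fun h => f h.castSucc) (fun h => f h.succ) (past s))) ∂(Measure.pi p0) := by
    intro past
    have hpost := isProbabilityMeasure_posterior (F := F) (p0 := p0) hB hl hη0 hγ hv past
    have hZ : 0 < ∫ f, Real.exp (posteriorExponent F l p0 η γ past f) ∂(Measure.pi p0) :=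
      integral_exp_pos (integrable_exp_posteriorExponent hB hl hη0 hγ hv past)
    set Z := ∫ f, Real.exp (posteriorExponent F l p0 η γ past f) ∂(Measure.pi p0)
    calc _ ≤ ∫⁻ f, (ENNReal.ofReal (K + b - 2) + ENNReal.ofReal (meanExcessMoment M l p0 η past)
          + ENNReal.ofReal (Real.exp (∑ s, logWeight M l πexp η
            (fun h => f h.castSucc) (fun h => f h.succ) (past s)
            - posteriorExponent F l p0 η γ past f) * Z)) ∂(posterior F l p0 η γ past) := by
          refine lintegral_mono fun f => ?_
          have := roundLoss_le (πexp := πexp) hc hB hl hη0 hγ hv hk hkκ hκ past f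
          -- The assumption 2 ≤ K + b enters here: `ENNReal.ofReal` is additive only on non-negative
          -- summands.
          rw [← ENNReal.ofReal_add (by linarith) (meanExcessMoment_pos hc hB hl hη0 past).le,
            ← ENNReal.ofReal_add (add_nonneg (by linarith)
              (meanExcessMoment_pos hc hB hl hη0 past).le) (by positivity)]
          exact ENNReal.ofReal_le_ofReal (by linarith)
      _ = ENNReal.ofReal (K + b - 2) + ENNReal.ofReal (meanExcessMoment M l p0 η past)
          + ∫⁻ f, ENNReal.ofReal (Real.exp (∑ s, logWeight M l πexp η
            (fun h => f h.castSucc) (fun h => f h.succ) (past s)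
            - posteriorExponent F l p0 η γ past f) * Z) ∂(posterior F l p0 η γ past) := by
          rw [lintegral_add_left measurable_const]
          simp
      _ = _ := by
          congr 1
          -- The posterior density e^Ψ/Z cancels e^{-Ψ}Z and leaves a prior integral that no longer
          -- involves the posterior.
          rw [posterior, lintegral_tilted]
          refine lintegral_congr fun f => ?_
          rw [← ENNReal.ofReal_mul (by positivity)]
          congr 1
          change Real.exp (posteriorExponent F l p0 η γ past f) / Z * _ = _
          rw [Real.exp_sub]
          have := (Real.exp_pos (posteriorExponent F l p0 η γ past f)).ne'
          field_simp
  have hmI : Measurable fun past : Fin t → Record S A H 𝓗 =>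
      ENNReal.ofReal (K + b - 2) + ENNReal.ofReal (meanExcessMoment M l p0 η past) :=
    (hl.meanExcessMoment t).ennreal_ofReal.const_add _
  refine (lintegral_mono inner).trans ?_
  rw [lintegral_add_left hmI, lintegral_add_left measurable_const]
  refine (add_le_add (add_le_add le_rfl
    (lintegral_runLaw_meanExcessMoment_le_one hc hB0 hB hl hπ hη hγ hv t))
    (lintegral_runLaw_prior_le_one hc hB0 hB hl hπ hη hγ hv t)).trans ?_
  simp only [lintegral_const, measure_univ, mul_one]
  refine le_of_eq ?_
  -- The two averages of mean at most one restore the 2 that log u ≤ u - 1 had gained.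
  rw [← ENNReal.ofReal_one, ← ENNReal.ofReal_add (by linarith) zero_le_one,
    ← ENNReal.ofReal_add (by linarith) zero_le_one]
  congr 1
  ring

end Class

end ModelFree

/-! ### Finite classes, and the reduction of the regret to round losses. -/

namespace ModelFree

lemma sum_filter_lt_eq {T : ℕ} (t : Fin T) (φ : Fin T → ℝ) :
    ∑ s ∈ Finset.univ.filter (· < t), φ s = ∑ s : Fin t, φ (Fin.castLE t.2.le s) := by
  symm
  refine Finset.sum_bij (fun s _ => Fin.castLE t.2.le s) (fun s _ => ?_)
    (fun a _ b _ hab => Fin.castLE_injective _ hab) (fun s hs => ?_) fun _ _ => rfl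
  · exact Finset.mem_filter.2 ⟨Finset.mem_univ _, s.2⟩
  · exact ⟨⟨s, (Finset.mem_filter.1 hs).2⟩, Finset.mem_univ _, rfl⟩

/-- The integrand may change sign: `ENNReal.ofReal` sees only the positive part, which dominates the
integral. -/
lemma integral_le_of_lintegral_ofReal_le {α : Type*} [MeasurableSpace α] {μ : Measure α} {f : α → ℝ}
    (hf : Integrable f μ) {c : ℝ} (hc : 0 ≤ c) (h : ∫⁻ x, ENNReal.ofReal (f x) ∂μ ≤ ENNReal.ofReal c) :
    ∫ x, f x ∂μ ≤ c := by
  have h1 : ∫ x, f x ∂μ ≤ ∫ x, max (f x) 0 ∂μ :=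
    integral_mono hf hf.pos_part fun x => le_max_left _ _
  refine h1.trans ?_
  rw [integral_eq_lintegral_of_nonneg_ae (f := fun x => max (f x) 0) (Filter.Eventually.of_forall fun x => le_max_right _ _)
    (show Integrable (fun x => max (f x) 0) μ from hf.pos_part).aestronglyMeasurable]
  refine ENNReal.toReal_le_of_le_ofReal hc (le_trans (le_of_eq (lintegral_congr fun x => ?_)) h)
  rw [ENNReal.ofReal_max]; simp

lemma exp_neg_le_of_negLog_le {p : ℝ≥0∞} {x : ℝ} (hp : p ≠ ⊤) (hx : 0 ≤ x)
    (h : negLog p ≤ ENNReal.ofReal x) : Real.exp (-x) ≤ p.toReal := by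
  unfold negLog at h
  split_ifs at h with h0
  · simp at h
  · rw [ENNReal.ofReal_le_ofReal_iff hx] at h
    exact (Real.le_log_iff_exp_le (ENNReal.toReal_pos h0 hp)).1 (by linarith)

lemma negLog_le_of_inv_le {p : ℝ≥0∞} {n : ℕ} (hp : p ≠ ⊤) (hn : 0 < n)
    (h : (n : ℝ≥0∞)⁻¹ ≤ p) : negLog p ≤ ENNReal.ofReal (Real.log n) := by
  have hn' : (0 : ℝ) < n := by exact_mod_cast hn
  have h0 : p ≠ 0 := fun h0 => by
    rw [h0] at h
    simp at h
  rw [negLog, if_neg h0]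
  refine ENNReal.ofReal_le_ofReal ?_
  have h1 : (n : ℝ)⁻¹ ≤ p.toReal := by
    have := ENNReal.toReal_mono hp h
    simpa using this
  have := Real.log_le_log (inv_pos.2 hn') h1
  rw [Real.log_inv] at this
  linarith

/-- Only an inequality, since singletons are not assumed measurable; counting measure dominates
cardinality on every set. -/
lemma inv_card_le_uniformOn_singleton {α : Type*} [MeasurableSpace α] [Finite α] (x : α) :
    (Nat.card α : ℝ≥0∞)⁻¹ ≤ uniformOn (Set.univ : Set α) {x} := by
  have := Fintype.ofFinite α
  rw [uniformOn_univ, Nat.card_eq_fintype_card, ← one_div]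
  refine ENNReal.div_le_div_right (le_trans ?_ Measure.le_count_apply) _
  simp

namespace MDP

variable {S A : Type*} [MeasurableSpace S] [MeasurableSpace A] {H : ℕ} (M : MDP S A H)

lemma optValue_mem_Icc [Nonempty (Policy S A)] : M.optValue ∈ Set.Icc (0 : ℝ) 1 := by
  refine ⟨?_, ciSup_le fun π => (M.value_mem_Icc π).2⟩
  obtain ⟨π⟩ := ‹Nonempty (Policy S A)›
  exact (M.value_mem_Icc π).1.trans
    (le_ciSup (f := M.value) ⟨1, by rintro _ ⟨π, rfl⟩; exact (M.value_mem_Icc π).2⟩ π)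

end MDP

lemma burnIn_mono {d d' : ℝ} (H T : ℕ) (ε : ℝ) (h : d' ≤ d) :
    burnIn d' H T ε ≤ burnIn d H T ε := by
  unfold burnIn
  gcongr

lemma burnIn_two_mul_le {d : ℝ} (H T : ℕ) :
    burnIn (2 * d) H T (1 / √T) ≤ 2 * burnIn d H T (1 / √T) := by
  unfold burnIn
  have h1 : √(2 * d * H * T) ≤ 2 * √(d * H * T) := by
    rcases le_total 0 (d * H * T) with h | h
    · rw [Real.sqrt_le_left (by positivity), mul_pow, Real.sq_sqrt h]
      nlinarith
    · rw [Real.sqrt_eq_zero_of_nonpos (by nlinarith)]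
      positivity
  have h2 : 0 ≤ 1 / √(T : ℝ) * H * T := by positivity
  linarith

/-- Since d·H·(HT)·K = H²·dTK, the first two bounds are H times the per-iteration bound; the third
is weaker by √H in its main term. Replacing a burn-in that does not dominate by the main term
doubles 20 to 40. -/
lemma regretBound_of_le {B d κ K reg : ℝ} {H T : ℕ} (hB : 0 ≤ B) (hd : 0 ≤ d) (hH : 0 < H)
    (hκ : κ ≤ K) (h : reg ≤ 20 * (B * √(d * T * κ) + burnIn d H T (1 / √T))) :
    RegretBound 40 B d K H T reg := by
  have hH1 : (1 : ℝ) ≤ H := by exact_mod_cast hH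
  have hb : 0 ≤ burnIn d H T (1 / √T) := by unfold burnIn; positivity
  have h1 : √(d * T * κ) ≤ √(d * T * K) := Real.sqrt_le_sqrt (by gcongr)
  have h2 : reg ≤ 20 * (B * √(d * T * K) + burnIn d H T (1 / √T)) :=
    h.trans (by gcongr)
  have h3 : √(d * H * (H * T) * K) = H * √(d * T * K) := by
    rw [show d * H * (H * T) * K = H ^ 2 * (d * T * K) by ring, Real.sqrt_mul (sq_nonneg _),
      Real.sqrt_sq (by linarith)]
  have h4 : √(d * T * K) ≤ √(d * H * T * K) := by
    rw [show d * H * T * K = H * (d * T * K) by ring, Real.sqrt_mul (x := (H : ℝ)) (by linarith)]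
    exact le_mul_of_one_le_left (Real.sqrt_nonneg _) (Real.one_le_sqrt.2 hH1)
  have h5 : H * reg ≤ H * (20 * (B * √(d * T * K) + burnIn d H T (1 / √T))) :=
    mul_le_mul_of_nonneg_left h2 (by linarith)
  have h6 : B * √(d * T * K) ≤ B * √(d * H * T * K) := mul_le_mul_of_nonneg_left h4 hB
  have h7 : 0 ≤ B * √(d * T * K) := mul_nonneg hB (Real.sqrt_nonneg _)
  have h8 : 0 ≤ H * (B * √(d * T * K)) := by positivity
  have h9 : 0 ≤ H * burnIn d H T (1 / √T) := by positivity
  refine ⟨?_, fun hle => ?_, fun hle => ?_⟩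
  · rw [h3]; nlinarith
  · rw [h3] at hle ⊢; nlinarith
  · linarith

section Class

variable {S A : Type*} [MeasurableSpace S] [MeasurableSpace A] {H : ℕ} {M : MDP S A H}
  {𝓗 : Fin (H + 1) → Type*} [∀ i, MeasurableSpace (𝓗 i)] {F : HypothesisClass M 𝓗}
  {l : Loss S A H 𝓗} {πexp : (∀ i, 𝓗 i) → Fin H → Policy S A}
  {p0 : ∀ i, Measure (𝓗 i)} [∀ i, IsProbabilityMeasure (p0 i)] {η γ v B : ℝ}
  {fstar : ∀ i, 𝓗 i} {ε κ : ℝ} {k : Fin H → ℝ}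
  {ℓ : (∀ i, 𝓗 i) → (∀ i, 𝓗 i) → Fin H → S × A → ℝ}

lemma GeneralizedCompleteness.condLoss_fstar (hc : GeneralizedCompleteness M l fstar)
    (f' : ∀ i, 𝓗 i) (h : Fin H) (xa : S × A) :
    condLoss M l f' h (fstar h.castSucc) (fstar h.succ) xa = 0 := by
  obtain ⟨op, h1, h2⟩ := hc
  -- The next state of the sample is irrelevant to the right-hand side; the current state serves as
  -- an available element of S.
  have := h1 f' h (fstar h.castSucc) (fstar h.succ) (xa.1, xa.2, xa.1)
  rw [h2, sub_self] at this
  exact this.symm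

/-- The completion of g' has conditional mean loss exactly zero: in the completeness identity it is
compared with itself. -/
lemma GeneralizedCompleteness.nearComplete_nonempty (hc : GeneralizedCompleteness M l fstar)
    (hε : 0 ≤ ε) (h : Fin H) (g' : 𝓗 h.succ) : (nearComplete M l ε h g').Nonempty := by
  obtain ⟨op, h1, h2⟩ := hc
  refine ⟨op h g', fun f' xa => ?_⟩
  have := h1 f' h (op h g') g' (xa.1, xa.2, xa.1)
  rw [sub_self] at this
  rw [← this]
  simpa using hε

/-- For uniform priors on a finite class, `κ` is at most the logarithm of the cardinality. -/
lemma kappa_le_log_card [Unique (𝓗 (Fin.last H))] [∀ i, Finite (𝓗 i)]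
    (hp0 : ∀ i, p0 i = uniformOn Set.univ) (hc : GeneralizedCompleteness M l fstar) (hε : 0 < ε) :
    kappa F l fstar p0 ε ≤ ENNReal.ofReal (Real.log (Nat.card (∀ i, 𝓗 i))) := by
  have hne : ∀ i, Nonempty (𝓗 i) := fun i => ⟨fstar i⟩
  have hpos : ∀ i, 0 < Nat.card (𝓗 i) := fun i => Nat.card_pos
  have hcard : Nat.card (∀ i, 𝓗 i) = ∏ i, Nat.card (𝓗 i) := Nat.card_pi
  have hs : ∀ i x, (Nat.card (𝓗 i) : ℝ≥0∞)⁻¹ ≤ p0 i {x} := fun i x => by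
    rw [hp0]; exact inv_card_le_uniformOn_singleton x
  refine max_le ?_ ?_
  · calc kappaC M l p0 ε
        ≤ ∑ h : Fin H, ENNReal.ofReal (Real.log (Nat.card (𝓗 h.castSucc))) :=
          Finset.sum_le_sum fun h _ => iSup_le fun g' => by
            obtain ⟨g, hg⟩ := hc.nearComplete_nonempty hε.le h g'
            exact negLog_le_of_inv_le (measure_ne_top _ _) (hpos _)
              ((hs _ g).trans (measure_mono (Set.singleton_subset_iff.2 hg)))
      _ = ENNReal.ofReal (Real.log (Nat.card (∀ i, 𝓗 i))) := by
          -- The sum runs over the first H components only; the dummy last one has cardinality one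
          -- and does not affect the product.
          rw [← ENNReal.ofReal_sum_of_nonneg fun h _ => Real.log_natCast_nonneg _, hcard,
            Fin.prod_univ_castSucc, Nat.card_unique, mul_one, Nat.cast_prod, Real.log_prod]
          intro h _
          exact_mod_cast (hpos _).ne'
  · refine negLog_le_of_inv_le (measure_ne_top _ _) Nat.card_pos ?_
    have hmem : fstar ∈ nearOptimal F l fstar ε :=
      ⟨by simpa using hε, fun f' h xa => by rw [hc.condLoss_fstar]; simpa using hε.le⟩
    refine le_trans ?_ (measure_mono (Set.singleton_subset_iff.2 hmem))
    rw [← Set.univ_pi_singleton, Measure.pi_pi, hcard, Nat.cast_prod,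
      ENNReal.prod_inv_distrib fun i _ _ _ _ => Or.inr (by simp)]
    exact Finset.prod_le_prod' fun i _ => hs i _

/-- The hypotheses of a class with finite eluder coefficient predict values that are bounded
above. -/
lemma GECBound.predValue_le {T : ℕ} (hT : 0 < T) {d' : ℝ} (hd' : 0 ≤ d')
    (hgec : GECBound F ℓ πexp ε T d') (hε : 0 ≤ ε) (hℓ : IsDiscrepancyOf M ℓ l)
    (hB : BoundedLoss M l B) (hl : MeasurableLoss l) (f : ∀ i, 𝓗 i) :
    F.predValue f ≤ 1 + (√(d' * (H * (T * (T * B ^ 2)))) + burnIn d' H T ε) := by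
  -- On a constant sequence the left side is T(V_f - V^{π_f}), while every discrepancy is at most
  -- B². This bounds V_f uniformly in f and so makes the posterior proper.
  have h := hgec fun _ => f
  have hb : 0 ≤ burnIn d' H T ε := by unfold burnIn; positivity
  have hsum : ∑ h : Fin H, ∑ t : Fin T, ∑ s ∈ Finset.univ.filter (· < t),
      ∫ y, ℓ f f h (y.1, y.2.1) ∂(M.stepLaw (πexp f h) h) ≤ H * (T * (T * B ^ 2)) := by
    have hle : ∀ h : Fin H, ∫ y, ℓ f f h (y.1, y.2.1) ∂(M.stepLaw (πexp f h) h) ≤ B ^ 2 :=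
      fun h => by
        simp only [hℓ f f h, sq_abs]
        exact meanDiscrepancy_le hB hl πexp f h _ _
    calc _ ≤ ∑ _h : Fin H, ∑ _t : Fin T, ∑ _s : Fin T, B ^ 2 :=
          Finset.sum_le_sum fun h _ => Finset.sum_le_sum fun t _ =>
            (Finset.sum_le_sum fun s _ => hle h).trans
              (Finset.sum_le_sum_of_subset_of_nonneg (Finset.filter_subset _ _)
                fun _ _ _ => sq_nonneg _)
      _ = _ := by simp
  have h2 : (T : ℝ) * (F.predValue f - M.value (F.greedyPolicy f))
      ≤ √(d' * (H * (T * (T * B ^ 2)))) + burnIn d' H T ε := by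
    have h3 := Real.sqrt_le_sqrt (mul_le_mul_of_nonneg_left hsum hd')
    simp only [Finset.sum_const, Finset.card_univ, Fintype.card_fin, nsmul_eq_mul] at h h3 ⊢
    linarith
  have hT1 : (1 : ℝ) ≤ T := by exact_mod_cast hT
  have hv := (M.value_mem_Icc (F.greedyPolicy f)).2
  by_contra! hlt
  have h0 : 0 ≤ √(d' * (H * (T * (T * B ^ 2)))) + burnIn d' H T ε := by positivity
  nlinarith

/-- The sum of the expected round losses, each shifted by `b`. -/
lemma lintegral_sum_roundLoss_le {T : ℕ} {K b : ℝ} (hB : BoundedLoss M l B) (hl : MeasurableLoss l)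
    (hπ : MeasurableExploration πexp) (hη : 0 ≤ η) (hγ : 0 ≤ γ) (hv : ∀ f, F.predValue f ≤ v)
    (hround : ∀ t < T, ∫⁻ past, ∫⁻ f, ENNReal.ofReal (roundLoss F l πexp η γ fstar past f + b)
      ∂(posterior F l p0 η γ past) ∂(runLaw F l πexp p0 η γ t) ≤ ENNReal.ofReal (K + b))
    (t : ℕ) (ht : t ≤ T) :
    ∫⁻ ω, ∑ j : Fin t, ENNReal.ofReal (roundLoss F l πexp η γ fstar
      (fun s : Fin j => ω (Fin.castLE j.2.le s)) (ω j).1 + b) ∂(runLaw F l πexp p0 η γ t)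
      ≤ t * ENNReal.ofReal (K + b) := by
  have hm : ∀ t : ℕ, Measurable fun ω : Fin t → Record S A H 𝓗 =>
      ∑ j : Fin t, ENNReal.ofReal (roundLoss F l πexp η γ fstar
        (fun s : Fin j => ω (Fin.castLE j.2.le s)) (ω j).1 + b) := fun t =>
    Finset.measurable_fun_sum _ fun j _ => Measurable.ennreal_ofReal (Measurable.add_const
      ((hl.roundLoss hπ j).comp (f := fun ω : Fin t → Record S A H 𝓗 =>
        ((fun s : Fin j => ω (Fin.castLE j.2.le s)), (ω j).1)) (by fun_prop)) b)
  induction t with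
  | zero => simp
  | succ t ih =>
    rw [lintegral_runLaw_succ hB hl hπ hη hγ hv (hm (t + 1))]
    have key : ∀ (past : Fin t → Record S A H 𝓗) (r : Record S A H 𝓗),
        ∑ j : Fin (t + 1), ENNReal.ofReal (roundLoss F l πexp η γ fstar
          (fun s : Fin j => (Fin.snoc (α := fun _ => Record S A H 𝓗) past r :
            Fin (t + 1) → Record S A H 𝓗) (Fin.castLE j.2.le s))
          ((Fin.snoc (α := fun _ => Record S A H 𝓗) past r :
            Fin (t + 1) → Record S A H 𝓗) j).1 + b)
        = ∑ j : Fin t, ENNReal.ofReal (roundLoss F l πexp η γ fstar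
            (fun s : Fin j => past (Fin.castLE j.2.le s)) (past j).1 + b)
          + ENNReal.ofReal (roundLoss F l πexp η γ fstar past r.1 + b) := by
      intro past r
      have hsnoc : ∀ i : Fin t, (Fin.snoc (α := fun _ => Record S A H 𝓗) past r :
          Fin (t + 1) → Record S A H 𝓗) i.castSucc = past i := fun i => Fin.snoc_castSucc ..
      have hlast : (Fin.snoc (α := fun _ => Record S A H 𝓗) past r :
          Fin (t + 1) → Record S A H 𝓗) (Fin.last t) = r := Fin.snoc_last ..
      rw [Fin.sum_univ_castSucc, hlast]
      congr 1
      · refine Finset.sum_congr rfl fun j _ => ?_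
        rw [hsnoc]
        have : (fun s : Fin (j.castSucc : ℕ) => (Fin.snoc (α := fun _ => Record S A H 𝓗) past r :
            Fin (t + 1) → Record S A H 𝓗) (Fin.castLE j.castSucc.2.le s))
            = fun s : Fin j => past (Fin.castLE j.2.le s) :=
          funext fun s => hsnoc (Fin.castLE j.2.le s)
        rw [this]
      · have : (fun s : Fin (Fin.last t : ℕ) => (Fin.snoc (α := fun _ => Record S A H 𝓗) past r :
            Fin (t + 1) → Record S A H 𝓗) (Fin.castLE (Fin.last t).2.le s)) = past :=
          funext fun s => hsnoc s
        rw [this]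
    simp only [key]
    calc _ = ∫⁻ past, (∑ j : Fin t, ENNReal.ofReal (roundLoss F l πexp η γ fstar
            (fun s : Fin j => past (Fin.castLE j.2.le s)) (past j).1 + b)
          + ∫⁻ f, ENNReal.ofReal (roundLoss F l πexp η γ fstar past f + b)
            ∂(posterior F l p0 η γ past)) ∂(runLaw F l πexp p0 η γ t) := by
          refine lintegral_congr fun past => ?_
          have := isProbabilityMeasure_posterior (F := F) (p0 := p0) hB hl hη hγ hv past
          simp only [lintegral_const, measure_univ, mul_one]
          rw [lintegral_add_left measurable_const]
          simp
      _ ≤ t * ENNReal.ofReal (K + b) + ENNReal.ofReal (K + b) := by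
          rw [lintegral_add_left (hm t)]
          exact add_le_add (ih (by omega)) (hround t (by omega))
      _ = _ := by push_cast; ring

/-- The regret of a run is controlled by its round losses and the eluder coefficient. -/
lemma regret_le_sum_roundLoss {T : ℕ} {d' : ℝ} (hd' : 0 ≤ d') (hη : 0 < η) (hγ : 0 ≤ γ)
    (hgec : GECBound F ℓ πexp ε T d') (hℓ : IsDiscrepancyOf M ℓ l)
    (hopt : M.optValue ≤ F.predValue fstar) (ω : Fin T → Record S A H 𝓗) :
    γ * ∑ t, (M.optValue - M.value (F.greedyPolicy (ω t).1)) ≤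
      ∑ t : Fin T, roundLoss F l πexp η γ fstar (fun s : Fin t => ω (Fin.castLE t.2.le s)) (ω t).1
        + 5 / 2 * γ ^ 2 * d' / η + γ * burnIn d' H T ε := by
  have h := hgec fun t => (ω t).1
  have hX : ∑ h : Fin H, ∑ t : Fin T, ∑ s ∈ Finset.univ.filter (· < t),
      ∫ y, ℓ (ω s).1 (ω t).1 h (y.1, y.2.1) ∂(M.stepLaw (πexp (ω s).1 h) h)
      = ∑ t : Fin T, ∑ s : Fin t, ∑ h, meanDiscrepancy M l πexp (ω (Fin.castLE t.2.le s)).1 h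
        ((ω t).1 h.castSucc) ((ω t).1 h.succ) := by
    rw [Finset.sum_comm]
    refine Finset.sum_congr rfl fun t _ => ?_
    rw [Finset.sum_comm, ← sum_filter_lt_eq t fun s => ∑ h, meanDiscrepancy M l πexp (ω s).1 h
        ((ω t).1 h.castSucc) ((ω t).1 h.succ)]
    refine Finset.sum_congr rfl fun s _ => Finset.sum_congr rfl fun h _ => ?_
    simp only [hℓ _ _ h, sq_abs]
    rfl
  rw [hX] at h
  set X := ∑ t : Fin T, ∑ s : Fin t, ∑ h, meanDiscrepancy M l πexp (ω (Fin.castLE t.2.le s)).1 h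
        ((ω t).1 h.castSucc) ((ω t).1 h.succ) with hXdef
  have hX0 : 0 ≤ X := Finset.sum_nonneg fun t _ => Finset.sum_nonneg fun s _ =>
    Finset.sum_nonneg fun h _ => meanDiscrepancy_nonneg _ _ _ _ _ _
  have hround : ∑ t : Fin T, roundLoss F l πexp η γ fstar
      (fun s : Fin t => ω (Fin.castLE t.2.le s)) (ω t).1
      = γ * ∑ t, (F.predValue fstar - F.predValue (ω t).1) + η / 10 * X := by
    simp only [roundLoss, Finset.sum_add_distrib, hXdef, Finset.mul_sum]
  -- The arithmetic-geometric inequality, weighted so that X gets exactly the factor η/10 it has in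
  -- the round losses.
  have hsq : γ * √(d' * X) ≤ η / 10 * X + 5 / 2 * γ ^ 2 * d' / η := by
    have h1 : (√(d' * X)) ^ 2 = d' * X := Real.sq_sqrt (mul_nonneg hd' hX0)
    rw [Real.sqrt_mul hd']
    have h2 := Real.sq_sqrt hX0
    have h3 := Real.sq_sqrt hd'
    have h4 : η / 10 * X + 5 / 2 * γ ^ 2 * d' / η - γ * (√d' * √X)
        = (η * √X - 5 * γ * √d') ^ 2 / (10 * η) := by
      field_simp
      ring_nf
      rw [h2, h3]
    have : 0 ≤ (η * √X - 5 * γ * √d') ^ 2 / (10 * η) := by positivity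
    linarith
  have hsplit : ∑ t, (M.optValue - M.value (F.greedyPolicy (ω t).1)) ≤
      ∑ t, (F.predValue fstar - F.predValue (ω t).1)
      + ∑ t, (F.predValue (ω t).1 - M.value (F.greedyPolicy (ω t).1)) := by
    rw [← Finset.sum_add_distrib]
    exact Finset.sum_le_sum fun t _ => by linarith
  have := mul_le_mul_of_nonneg_left (hsplit.trans (add_le_add_right h _)) hγ
  rw [hround]
  linarith

end Class

end ModelFree

/-! ### Choice of γ and assembly of the regret bound. -/

namespace ModelFree

/-- γ makes the costs Tκ/γ and γB²d both equal to B√(dTκ). The last two bounds let the burn-in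
absorb the resolution error; H ≤ T²κ enters only in the last, as H² ≤ H·T²κ = B²γ²·dHT. -/
lemma tune_constants {B d κ γ : ℝ} {H T : ℕ} (hH : 0 < H) (hT : 0 < T) (hB : 0 < B) (hd : 0 < d)
    (hκ : 0 < κ) (hHT : (H : ℝ) ≤ (T : ℝ) ^ 2 * κ) (hγ : γ = √(T * κ / (B ^ 2 * d))) :
    0 < γ ∧ T * κ = γ * (B * √(d * T * κ)) ∧ γ ^ 2 * d * B ^ 2 = T * κ ∧
      1 / (T : ℝ) ≤ burnIn d H T (1 / √T) ∧ 2 * (H / B) ≤ γ * burnIn d H T (1 / √T) := by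
  have hT' : (0 : ℝ) < T := by exact_mod_cast hT
  have hH' : (0 : ℝ) < H := by exact_mod_cast hH
  have hT1 : (1 : ℝ) ≤ T := by exact_mod_cast hT
  have hH1 : (1 : ℝ) ≤ H := by exact_mod_cast hH
  have hγ0 : 0 < γ := by rw [hγ]; positivity
  have hγ2 : γ ^ 2 = T * κ / (B ^ 2 * d) := by rw [hγ, Real.sq_sqrt (by positivity)]
  have hγd : γ ^ 2 * d * B ^ 2 = T * κ := by rw [hγ2]; field_simp
  refine ⟨hγ0, ?_, hγd, ?_, ?_⟩
  · have h1 : (γ * (B * √(d * T * κ))) ^ 2 = (T * κ) ^ 2 := by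
      rw [mul_pow, mul_pow, Real.sq_sqrt (by positivity), hγ2]
      field_simp
    exact ((sq_eq_sq₀ (by positivity) (by positivity)).1 h1).symm
  · have h1 : 1 ≤ 1 / √(T : ℝ) * H * T := by
      have h2 : 1 / √(T : ℝ) * H * T = H * √T := by
        have := Real.mul_self_sqrt hT'.le
        have h3 : 0 < √(T : ℝ) := Real.sqrt_pos.2 hT'
        field_simp
        nlinarith
      rw [h2]
      exact one_le_mul_of_one_le_of_one_le hH1 (Real.one_le_sqrt.2 hT1)
    have h2 : 1 / (T : ℝ) ≤ 1 := (div_le_one hT').2 hT1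
    have h3 : 0 ≤ 2 * √(d * H * T) := by positivity
    unfold burnIn
    linarith
  · have h1 : H / B ≤ γ * √(d * H * T) := by
      refine (pow_le_pow_iff_left₀ (by positivity) (by positivity) two_ne_zero).1 ?_
      rw [mul_pow, Real.sq_sqrt (by positivity), hγ2, div_pow]
      have h2 : T * κ / (B ^ 2 * d) * (d * H * T) = H * (T ^ 2 * κ) / B ^ 2 := by
        field_simp
      rw [h2]
      gcongr
      rw [sq]
      gcongr
    have h2 : 0 ≤ γ * (1 / √(T : ℝ) * H * T) := by positivity
    unfold burnIn
    linarith

section Class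

variable {S A : Type*} [MeasurableSpace S] [MeasurableSpace A] {H : ℕ} {M : MDP S A H}
  {𝓗 : Fin (H + 1) → Type*} [∀ i, MeasurableSpace (𝓗 i)] {F : HypothesisClass M 𝓗}
  {l : Loss S A H 𝓗} {πexp : (∀ i, 𝓗 i) → Fin H → Policy S A}
  {p0 : ∀ i, Measure (𝓗 i)} [∀ i, IsProbabilityMeasure (p0 i)] {η γ v B d κ : ℝ}
  {fstar : ∀ i, 𝓗 i} {ε : ℝ}
  {ℓ : (∀ i, 𝓗 i) → (∀ i, 𝓗 i) → Fin H → S × A → ℝ}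

/-- A finite sum forces every supremum to be finite, so their real values can serve as the exponents
k_h. -/
lemma exists_exp_neg_le_of_kappaC_le (hκ : 0 ≤ κ) (h : kappaC M l p0 ε ≤ ENNReal.ofReal κ) :
    ∃ k : Fin H → ℝ, (∀ (h : Fin H) (g' : 𝓗 h.succ),
      Real.exp (-k h) ≤ (p0 h.castSucc).real (nearComplete M l ε h g')) ∧ ∑ h, k h ≤ κ := by
  set s : Fin H → ℝ≥0∞ := fun h =>
    ⨆ g' : 𝓗 h.succ, negLog (p0 h.castSucc (nearComplete M l ε h g')) with hs
  have hsum : ∑ h, s h ≤ ENNReal.ofReal κ := h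
  have htop : ∀ h, s h ≠ ⊤ := fun h =>
    ne_top_of_le_ne_top ENNReal.ofReal_ne_top
      ((Finset.single_le_sum (fun _ _ => zero_le) (Finset.mem_univ h)).trans hsum)
  refine ⟨fun h => (s h).toReal, fun h g' => ?_, ?_⟩
  · refine exp_neg_le_of_negLog_le (measure_ne_top _ _) ENNReal.toReal_nonneg ?_
    rw [ENNReal.ofReal_toReal (htop h)]
    exact le_iSup (fun g' : 𝓗 h.succ => negLog (p0 h.castSucc (nearComplete M l ε h g'))) g'
  · rw [← ENNReal.toReal_sum fun h _ => htop h]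
    exact ENNReal.toReal_le_of_le_ofReal hκ hsum

lemma expRegret_le {T : ℕ} (hH : 0 < H) (hT : 0 < T) (hπ : MeasurableExploration πexp)
    (hl : MeasurableLoss l) (hreal : F.Realizes fstar) (hℓ : IsDiscrepancyOf M ℓ l)
    (hc : GeneralizedCompleteness M l fstar) (hB0 : 0 < B) (hB : BoundedLoss M l B) (hd : 0 < d)
    (hgec : GEC F ℓ πexp (1 / √T) T = ENNReal.ofReal d) (hκ0 : 0 ≤ κ)
    (hκ : kappa F l fstar p0 (1 / (T : ℝ) ^ 2) = ENNReal.ofReal κ)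
    (hHT : (H : ℝ) ≤ (T : ℝ) ^ 2 * κ) (hη : η = 3 / (10 * B ^ 2))
    (hγ : γ = √(T * κ / (B ^ 2 * d))) :
    expRegret F l πexp p0 η γ T ≤ 20 * (B * √(d * T * κ) + burnIn d H T (1 / √T)) := by
  have hT' : (0 : ℝ) < T := by exact_mod_cast hT
  have hH' : (0 : ℝ) < H := by exact_mod_cast hH
  have hκpos : 0 < κ := hκ0.lt_of_ne fun h => by rw [← h] at hHT; linarith
  obtain ⟨hγ0, hTκ, hγd, hburn1, hburn2⟩ := tune_constants hH hT hB0 hd hκpos hHT hγ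
  have hη0 : 0 < η := by rw [hη]; positivity
  have hηB : η * B ^ 2 = 3 / 10 := by rw [hη]; field_simp
  -- An admissible constant below 2d is chosen, so attainment of the infimum is not needed; the
  -- factor 2 goes into the absolute constant.
  obtain ⟨d', hd'⟩ : ∃ d' : ℝ≥0, GECBound F ℓ πexp (1 / √T) T d' ∧ (d' : ℝ≥0∞) < ENNReal.ofReal (2 * d) := by
    have : GEC F ℓ πexp (1 / √T) T < ENNReal.ofReal (2 * d) := by
      rw [hgec]; exact (ENNReal.ofReal_lt_ofReal_iff (by linarith)).2 (by linarith)
    simpa only [GEC, iInf_lt_iff, exists_prop] using this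
  obtain ⟨hgec', hdd⟩ := hd'
  have hd2 : (d' : ℝ) ≤ 2 * d := by
    have := ENNReal.toReal_le_of_le_ofReal (by linarith) hdd.le
    simpa using this
  have hv := fun f => hgec'.predValue_le hT d'.coe_nonneg (by positivity) hℓ hB hl f
  obtain ⟨k, hk, hkκ⟩ := exists_exp_neg_le_of_kappaC_le hκ0 ((le_max_left _ _).trans hκ.le)
  have hκr : Real.exp (-κ) ≤ (Measure.pi p0).real (nearOptimal F l fstar (1 / (T : ℝ) ^ 2)) :=
    exp_neg_le_of_negLog_le (measure_ne_top _ _) hκ0 ((le_max_right _ _).trans hκ.le)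
  set K := 3 * κ + γ * (1 / (T : ℝ) ^ 2) + 2 * (H * (η * (T * (3 * B * (1 / (T : ℝ) ^ 2))))) with hK
  have hK0 : 0 ≤ K := by positivity
  -- With shift 2 the requirement 2 ≤ K + b reduces to 0 ≤ K. The shift appears T times on both
  -- sides of `hmain` and cancels.
  have hround : ∀ t < T, ∫⁻ past, ∫⁻ f, ENNReal.ofReal (roundLoss F l πexp η γ fstar past f + 2)
      ∂(posterior F l p0 η γ past) ∂(runLaw F l πexp p0 η γ t) ≤ ENNReal.ofReal (K + 2) :=
    fun t ht => lintegral_roundLoss_le hc hB0 hB hl hπ hη hγ0.le hv hk hkκ hκr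
      (by have : (t : ℝ) ≤ T := by exact_mod_cast ht.le
          rw [hK]; gcongr) (by linarith)
  have hsum := lintegral_sum_roundLoss_le hB hl hπ hη0.le hγ0.le hv hround T le_rfl
  have hrun := isProbabilityMeasure_runLaw (F := F) (p0 := p0) hB hl hπ hη0.le hγ0.le hv T
  have hpol : Nonempty (Policy S A) := ⟨F.greedyPolicy fstar⟩
  set reg : (Fin T → Record S A H 𝓗) → ℝ :=
    fun ω => ∑ t, (M.optValue - M.value (F.greedyPolicy (ω t).1)) with hreg
  have hregi : Integrable reg (runLaw F l πexp p0 η γ T) := by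
    refine integrable_of_abs_le (Finset.measurable_fun_sum _ fun t _ => Measurable.const_sub
      (F.measurable_value_greedyPolicy.comp (measurable_fst.comp (measurable_pi_apply t))) _)
      (∑ _t : Fin T, 1) fun ω => (Finset.abs_sum_le_sum_abs _ _).trans
        (Finset.sum_le_sum fun t _ => ?_)
    have h1 := M.optValue_mem_Icc
    have h2 := M.value_mem_Icc (F.greedyPolicy (ω t).1)
    exact abs_le.2 ⟨by linarith [h1.1, h2.2], by linarith [h1.2, h2.1]⟩
  set c := T * 2 - 5 / 2 * γ ^ 2 * d' / η - γ * burnIn d' H T (1 / √T) with hcdef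
  have hmain : γ * ∫ ω, reg ω ∂(runLaw F l πexp p0 η γ T) + c ≤ T * (K + 2) := by
    have hi : Integrable (fun ω => γ * reg ω + c) (runLaw F l πexp p0 η γ T) :=
      (hregi.const_mul γ).add (integrable_const c)
    have := integral_le_of_lintegral_ofReal_le hi (c := T * (K + 2)) (by positivity) (by
      rw [ENNReal.ofReal_mul hT'.le, ENNReal.ofReal_natCast]
      refine (lintegral_mono fun ω => ?_).trans hsum
      have h1 : γ * reg ω ≤ _ := regret_le_sum_roundLoss (γ := γ) d'.coe_nonneg hη0 hγ0.le hgec' hℓ (hreal.optValue_le hH) ω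
      refine le_trans (ENNReal.ofReal_le_ofReal (q := ∑ t : Fin T, (roundLoss F l πexp η γ fstar
        (fun s : Fin t => ω (Fin.castLE t.2.le s)) (ω t).1 + 2)) ?_) ?_
      · rw [Finset.sum_add_distrib]
        simp only [Finset.sum_const, Finset.card_univ, Fintype.card_fin, nsmul_eq_mul]
        linarith
      -- Individual shifted round losses may be negative; subadditivity of `ENNReal.ofReal` is all
      -- that is needed.
      · exact Finset.le_sum_of_subadditive _ ENNReal.ofReal_zero.le
          (fun x y => ENNReal.ofReal_add_le) _ _)
    rwa [integral_add (hregi.const_mul γ) (integrable_const c), integral_const_mul, integral_const,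
      probReal_univ, one_smul] at this
  have hbd : burnIn d' H T (1 / √T) ≤ 2 * burnIn d H T (1 / √T) :=
    (burnIn_mono H T _ hd2).trans (burnIn_two_mul_le H T)
  -- At resolution 1/T² the likelihood error totals 6HηB = (9/5)H/B over T iterations.
  have hTK : T * K = 3 * (T * κ) + γ * (1 / T) + 9 / 5 * (H / B) := by
    rw [hK, hη]; field_simp; ring
  -- From d' ≤ 2d and 1/η = (10/3)B²: (5/2)·2·(10/3) = 50/3.
  have hquad : 5 / 2 * γ ^ 2 * d' / η ≤ 50 / 3 * (T * κ) := by
    rw [div_le_iff₀ hη0]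
    have h1 : 50 / 3 * (T * κ) * η = 5 * γ ^ 2 * d := by
      rw [← hγd]
      linear_combination (50 / 3 * γ ^ 2 * d) * hηB
    rw [h1]
    nlinarith [mul_le_mul_of_nonneg_left hd2 (sq_nonneg γ)]
  have hγb := mul_le_mul_of_nonneg_left hbd hγ0.le
  have hγ1 := mul_le_mul_of_nonneg_left hburn1 hγ0.le
  have hfin : γ * ∫ ω, reg ω ∂(runLaw F l πexp p0 η γ T) ≤
      γ * (20 * (B * √(d * T * κ) + burnIn d H T (1 / √T))) := by
    have hb0 : 0 ≤ γ * burnIn d H T (1 / √T) := by unfold burnIn; positivity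
    have hTκ0 : 0 ≤ T * κ := by positivity
    have hexp : γ * (20 * (B * √(d * T * κ) + burnIn d H T (1 / √T)))
        = 20 * (T * κ) + 20 * (γ * burnIn d H T (1 / √T)) := by rw [hTκ]; ring
    rw [hexp]
    -- The constant 20 covers 3 + 50/3 copies of Tκ and 1 + 9/10 + 2 copies of γ times the burn-in.
    linarith
  exact le_of_mul_le_mul_left hfin hγ0

end Class

end ModelFree

end

theorem theorem1 :
    ∃ C : ℝ, 0 < C ∧
      ∀ (S : Type*) [MeasurableSpace S] (A : Type*) [MeasurableSpace A]
        (H T : ℕ) (_ : 0 < H) (_ : 0 < T)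
        (M : ModelFree.MDP S A H)
        (𝓗 : Fin (H + 1) → Type*) [∀ i, MeasurableSpace (𝓗 i)] [Unique (𝓗 (Fin.last H))]
        (F : ModelFree.HypothesisClass M 𝓗)
        (fstar : ∀ i, 𝓗 i)
        (πexp : (∀ i, 𝓗 i) → Fin H → ModelFree.Policy S A)
        (_ : ModelFree.MeasurableExploration πexp)
        (ℓ : (∀ i, 𝓗 i) → (∀ i, 𝓗 i) → Fin H → S × A → ℝ)
        (l : ModelFree.Loss S A H 𝓗) (_ : ModelFree.MeasurableLoss l)
        (p0 : ∀ i, Measure (𝓗 i)) [∀ i, IsProbabilityMeasure (p0 i)]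
        (B d κ η γ : ℝ)
        -- the assumptions of the result
        (_ : F.Realizes fstar)
        (_ : ModelFree.IsDiscrepancyOf M ℓ l)
        (_ : ModelFree.GeneralizedCompleteness M l fstar)
        (_ : 0 < B) (_ : ModelFree.BoundedLoss M l B)
        -- `d` is the generalized eluder coefficient and `κ` is `κ(1/T², p⁰)`
        (_ : 0 < d) (_ : ModelFree.GEC F ℓ πexp (1 / √T) T = ENNReal.ofReal d)
        (_ : 0 ≤ κ) (_ : ModelFree.kappa F l fstar p0 (1 / (T : ℝ) ^ 2) = ENNReal.ofReal κ)
        -- `T` is large enough for the resolution `1/T²` to be harmless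
        (_ : (H : ℝ) ≤ (T : ℝ) ^ 2 * κ)
        -- the choice of the parameters
        (_ : η = 3 / (10 * B ^ 2)) (_ : γ = √(T * κ / (B ^ 2 * d))),
        ModelFree.RegretBound C B d κ H T (ModelFree.expRegret F l πexp p0 η γ T) ∧
        ((∀ i, Finite (𝓗 i)) → (∀ i, p0 i = uniformOn Set.univ) →
          ModelFree.RegretBound C B d (Real.log (Nat.card (∀ i, 𝓗 i))) H T
            (ModelFree.expRegret F l πexp p0 η γ T)) := by
  refine ⟨40, by norm_num, ?_⟩
  intro S _ A _ H T hH hT M 𝓗 _ _ F fstar πexp hπ ℓ l hl p0 _ B d κ η γ hreal hℓ hc hB0 hB hd hgec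
    hκ0 hκ hHT hη hγ
  have hreg := ModelFree.expRegret_le hH hT hπ hl hreal hℓ hc hB0 hB hd hgec hκ0 hκ hHT hη hγ
  refine ⟨ModelFree.regretBound_of_le hB0.le hd.le hH le_rfl hreg, fun hfin hp0 =>
    ModelFree.regretBound_of_le hB0.le hd.le hH ?_ hreg⟩
  have hT' : (0 : ℝ) < T := by exact_mod_cast hT
  -- The algorithm and γ still use κ; only the final bound is relaxed, being monotone in the
  -- complexity term.
  have h := ModelFree.kappa_le_log_card (F := F) (l := l) hp0 hc
    (show (0 : ℝ) < 1 / (T : ℝ) ^ 2 by positivity)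
  rw [hκ] at h
  exact (ENNReal.ofReal_le_ofReal_iff (Real.log_natCast_nonneg _)).1 h
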